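/- Let $P\subset\mathbb{R}^2$ be a lattice polygon, i.e. a closed region bounded by a simple closed polygonal curve (a closed polygon with at least three, pairwise distinct vertices, whose consecutive edges meet only in their common vertex and whose non-consecutive edges are disjoint) all of whose vertices lie in $\mathbb{Z}^2$; here $P$ consists of the curve together with the points it encloses, that is, the points lying in bounded connected components of the complement of the curve. Let $i$ be the number of points of $\mathbb{Z}^2$ in the interior of $P$ (enclosed by the curve and not on it), and let $u$ be the number of points of $\mathbb{Z}^2$ on the boundary curve of $P$. Both numbers are finite, and the area of $P$ is finite and equals $$i+\frac{u}{2}-1 .$$ -/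

import Mathlib

namespace Polygon

/-- A polygon in the plane is simple if it has at least three vertices, its vertices are pairwise
distinct, consecutive edges meet only in their common vertex, and non-consecutive edges are
disjoint (so its edges form a closed polygonal curve without self-intersections).
Straight angles at vertices are allowed. -/
structure IsSimple {n : ℕ} (P : Polygon (EuclideanSpace ℝ (Fin 2)) n) : Prop where
  three_le : 3 ≤ n
  injective : Function.Injective P.vertices
  adjacent : ∀ i : Fin n, P.edgeSet ℝ i ∩ P.edgeSet ℝ (finRotate n i) = {P (finRotate n i)}
  nonadjacent : ∀ i j : Fin n, i ≠ j → j ≠ finRotate n i → i ≠ finRotate n j →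
    Disjoint (P.edgeSet ℝ i) (P.edgeSet ℝ j)

/-- The open set enclosed by the boundary curve of the polygon: the union of the bounded
connected components of the complement of the boundary. -/
def inside {n : ℕ} (P : Polygon (EuclideanSpace ℝ (Fin 2)) n) :
    Set (EuclideanSpace ℝ (Fin 2)) :=
  {x | x ∉ P.boundary ℝ ∧ Bornology.IsBounded (connectedComponentIn (P.boundary ℝ)ᶜ x)}

/-- The polygon as a closed planar region: its boundary together with its inside. -/
def region {n : ℕ} (P : Polygon (EuclideanSpace ℝ (Fin 2)) n) :
    Set (EuclideanSpace ℝ (Fin 2)) :=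
  P.boundary ℝ ∪ P.inside

end Polygon

/-- The lattice points of the plane: the points with integer coordinates. -/
def latticePoints : Set (EuclideanSpace ℝ (Fin 2)) :=
  {x | ∀ k : Fin 2, ∃ z : ℤ, x k = (z : ℝ)}

/-- A lattice polygon: a simple polygon all of whose vertices are lattice points. -/
structure Polygon.IsLatticePolygon {n : ℕ} (P : Polygon (EuclideanSpace ℝ (Fin 2)) n) :
    Prop where
  isSimple : P.IsSimple
  vertices_mem : ∀ i : Fin n, P i ∈ latticePoints

/-!
# Pick's theorem for simple lattice polygons

Identify the plane with `ℂ`, and for a closed polygonal curve let `sweep v x` be the total signed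
angle swept, seen from `x`, by a point running once around the curve; an edge through `x` counts as
`0`. Off the curve this is `2π` times the winding number. Pick's formula is obtained by computing
the sum of `sweep v` over the integer lattice in two ways.

* *The lattice sum equals the integral* (`tsum_sweep_eq_integral`). The difference of the two is
  additive in the curve, so it suffices to consider triangles with a vertex at the origin. On
  these it is an antisymmetric function of two lattice vectors, and its invariance under lattice
  translations and point reflections already forces it to be bilinear
  (`add_left_of_triangle_invariant`). Hence it is a multiple of the determinant, and the triangle
  `0, 1, i` shows that the multiple is `0`.
* *The values of `sweep v` for a simple curve.* The direction from a point of one segment to a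
  point of a disjoint one is always defined, so its total turn around the square of parameters is
  zero (`viewAngle_square`). Summing over all edges, or over pairs of edges `i < j` as in Hopf's proof of
  the theorem on turning tangents, gives `sweep v (v k) + turn v k = c` at every vertex and a total
  turning of `2 c`, where `c = halfTurning v` is `π` or `-π` (`sum_turn`, `abs_sweep_add_turn`).
  Moreover `sweep v = c` on open edges.
* *The inside* (`isBounded_component_iff`). Near the curve, `sweep v` is within `3π` of `c`, so off
  the curve it can only be `0` or `2 c`, with both values occurring near every point of the curve.
  A small disc around a point of the curve is cut into two sectors, so only one of them has value
  `0`. As the curve is connected, the region where `sweep v` vanishes is a single component, the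
  unbounded one, and the inside is exactly where `sweep v = 2 c`.

With `i` enclosed lattice points, `u` lattice points on the curve and area `A` the two sides of the
first step are `2 c i + c u - 2 c` and `2 c A`.
-/

namespace PickTheorem

open Complex Real Set Filter Topology MeasureTheory

/-! ### Subtended angles -/

/-- The argument of a complex number, with the value on the negative real axis changed
from `π` to `0`. With this choice it changes sign under inversion everywhere. -/
noncomputable def slitArg (z : ℂ) : ℝ := if arg z = π then 0 else arg z

/-- The signed angle in `(-π, π)` under which the oriented segment from `a` to `b` is seen
from `x`. It is `0` when `x` lies on the segment. -/
noncomputable def viewAngle (x a b : ℂ) : ℝ := slitArg ((b - x) / (a - x))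

lemma slitArg_of_mem {z : ℂ} (hz : z ∈ slitPlane) : slitArg z = arg z := by
  rw [mem_slitPlane_iff_arg] at hz
  simp [slitArg, hz.1]

lemma slitArg_of_notMem {z : ℂ} (hz : z ∉ slitPlane) : slitArg z = 0 := by
  rw [mem_slitPlane_iff_arg] at hz
  unfold slitArg
  split_ifs with h
  · rfl
  · have : z = 0 := by tauto
    simp [this]

lemma slitArg_inv (z : ℂ) : slitArg z⁻¹ = -slitArg z := by
  unfold slitArg
  rw [arg_inv]
  split_ifs with h1 h2 h2
  · simp
  · simp at h2
  · exfalso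
    have := neg_pi_lt_arg z
    linarith
  · rfl

lemma abs_slitArg_lt (z : ℂ) : |slitArg z| < π := by
  unfold slitArg
  split_ifs with h
  · simpa using Real.pi_pos
  · rw [abs_lt]
    exact ⟨neg_pi_lt_arg z, lt_of_le_of_ne (arg_le_pi z) h⟩

lemma slitArg_coe {z : ℂ} (hz : z ∈ slitPlane) : (slitArg z : Real.Angle) = arg z := by
  rw [slitArg_of_mem hz]

lemma continuousAt_slitArg {z : ℂ} (hz : z ∈ slitPlane) : ContinuousAt slitArg z :=
  (continuousAt_arg hz).congr <| by
    filter_upwards [isOpen_slitPlane.mem_nhds hz] with w hw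
    rw [slitArg_of_mem hw]

lemma measurable_slitArg : Measurable slitArg :=
  Measurable.ite (measurable_arg (measurableSet_singleton π)) measurable_const measurable_arg

lemma measurable_viewAngle (a b : ℂ) : Measurable fun x => viewAngle x a b :=
  measurable_slitArg.comp (by fun_prop)

lemma abs_viewAngle_lt (x a b : ℂ) : |viewAngle x a b| < π := abs_slitArg_lt _

lemma viewAngle_symm (x a b : ℂ) : viewAngle x b a = -viewAngle x a b := by
  rw [viewAngle, viewAngle, ← slitArg_inv, inv_div]

lemma viewAngle_self (x a : ℂ) : viewAngle x a a = 0 := by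
  have := viewAngle_symm x a a
  linarith

lemma viewAngle_add (t x a b : ℂ) : viewAngle (x + t) (a + t) (b + t) = viewAngle x a b := by
  simp [viewAngle]

lemma viewAngle_neg (x a b : ℂ) : viewAngle (-x) (-a) (-b) = viewAngle x a b := by
  have h : ∀ c : ℂ, -c - -x = -(c - x) := fun c => by ring
  rw [viewAngle, viewAngle, h, h, neg_div_neg_eq]

@[simp] lemma viewAngle_left (a b : ℂ) : viewAngle a a b = 0 := by simp [viewAngle, slitArg]

@[simp] lemma viewAngle_right (a b : ℂ) : viewAngle b a b = 0 := by simp [viewAngle, slitArg]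

/-- A point lies off a segment exactly when the quotient of its difference vectors to the two
end points avoids the closed negative real axis. -/
lemma notMem_segment_iff {x a b : ℂ} :
    x ∉ segment ℝ a b ↔ (b - x) / (a - x) ∈ slitPlane := by
  rw [not_iff_comm]
  constructor
  · intro h
    by_cases hax : a - x = 0
    · rw [sub_eq_zero] at hax
      subst hax
      exact left_mem_segment ℝ _ _
    rw [mem_slitPlane_iff, not_or, not_lt, not_not] at h
    obtain ⟨h1, h2⟩ := h
    set q := (b - x) / (a - x) with hq
    have hqr : q = (q.re : ℂ) := by
      apply Complex.ext <;> simp [h2]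
    have hb : b - x = (q.re : ℂ) * (a - x) := by
      rw [← hqr, hq]; field_simp
    have hpos : 0 < 1 - q.re := by linarith
    refine ⟨-q.re / (1 - q.re), 1 / (1 - q.re), by apply div_nonneg <;> linarith, by positivity,
      by field_simp; ring, ?_⟩
    have hb' : b = x + (q.re : ℂ) * (a - x) := by linear_combination hb
    have hne : (1 - (q.re : ℂ)) ≠ 0 := by
      exact_mod_cast hpos.ne'
    generalize q.re = r at *
    rw [hb']
    simp only [real_smul]
    push_cast
    field_simp
    ring
  · rintro ⟨s, t, hs, ht, hst, rfl⟩ h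
    have h1 : b - (s • a + t • b) = (s : ℂ) * (b - a) := by
      have : (t : ℂ) = 1 - s := by rw [eq_sub_iff_add_eq']; exact_mod_cast hst
      simp only [real_smul, this]; ring
    have h2 : a - (s • a + t • b) = -((t : ℂ) * (b - a)) := by
      have : (s : ℂ) = 1 - t := by rw [eq_sub_iff_add_eq]; exact_mod_cast hst
      simp only [real_smul, this]; ring
    rw [h1, h2] at h
    by_cases hba : b - a = 0
    · simp [hba] at h
    · have : (s : ℂ) * (b - a) / (-((t : ℂ) * (b - a))) = ((-(s / t) : ℝ) : ℂ) := by
        rw [div_neg, mul_div_mul_right _ _ hba]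
        push_cast
        ring
      rw [this, ofReal_mem_slitPlane] at h
      have : 0 ≤ s / t := by positivity
      linarith

lemma viewAngle_of_mem {x a b : ℂ} (h : x ∈ segment ℝ a b) : viewAngle x a b = 0 := by
  by_contra h'
  exact h' (slitArg_of_notMem fun h'' => notMem_segment_iff.2 h'' h)

lemma viewAngle_coe {x a b : ℂ} (h : x ∉ segment ℝ a b) :
    (viewAngle x a b : Real.Angle) = arg (b - x) - arg (a - x) := by
  rw [viewAngle, slitArg_coe (notMem_segment_iff.1 h), arg_div_coe_angle]
  · rw [sub_ne_zero]
    rintro rfl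
    exact h (right_mem_segment ℝ _ _)
  · rw [sub_ne_zero]
    rintro rfl
    exact h (left_mem_segment ℝ _ _)

lemma continuousAt_viewAngle {X : Type*} [TopologicalSpace X] {x a b : X → ℂ} {p : X}
    (hx : ContinuousAt x p) (ha : ContinuousAt a p) (hb : ContinuousAt b p)
    (h : x p ∉ segment ℝ (a p) (b p)) :
    ContinuousAt (fun y => viewAngle (x y) (a y) (b y)) p := by
  refine ContinuousAt.comp (g := slitArg) (f := fun y => (b y - x y) / (a y - x y))
    (continuousAt_slitArg (notMem_segment_iff.1 h)) ?_
  refine (hb.sub hx).div (ha.sub hx) ?_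
  rw [sub_ne_zero]
  intro h'
  rw [← h'] at h
  exact h (left_mem_segment ℝ _ _)

/-- A continuous function whose values are multiples of `2π` is constant on preconnected sets. -/
lemma eq_of_coe_angle_eq_zero {X : Type*} [TopologicalSpace X] {S : Set X}
    (hS : IsPreconnected S) {f : X → ℝ} (hf : ContinuousOn f S)
    (h : ∀ x ∈ S, (f x : Real.Angle) = 0) {x y : X} (hx : x ∈ S) (hy : y ∈ S) : f x = f y := by
  have hmaps : MapsTo (fun x => f x / (2 * π)) S (range ((↑) : ℤ → ℝ)) := by
    intro z hz
    obtain ⟨m, hm⟩ := Real.Angle.coe_eq_zero_iff.1 (h z hz)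
    refine ⟨m, ?_⟩
    simp only
    rw [← hm, zsmul_eq_mul]
    field_simp
  have hd : IsDiscrete (range ((↑) : ℤ → ℝ)) := by
    rw [isDiscrete_iff_discreteTopology]
    exact Int.isClosedEmbedding_coe_real.isEmbedding.toHomeomorph.symm.isEmbedding.discreteTopology
  have := hS.constant_of_mapsTo hd (hf.div_const _) hmaps hx hy
  have hp := Real.pi_pos
  field_simp at this
  exact this

lemma eq_zero_of_coe_angle_eq_zero {r : ℝ} (h : (r : Real.Angle) = 0) (hr : |r| < 2 * π) :
    r = 0 := by
  obtain ⟨m, rfl⟩ := Real.Angle.coe_eq_zero_iff.1 h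
  rw [zsmul_eq_mul, abs_mul, abs_of_pos Real.two_pi_pos] at hr
  have : |(m : ℝ)| < 1 := by
    by_contra! h'
    nlinarith [Real.pi_pos]
  have : m = 0 := by
    rw [← Int.cast_abs] at this
    exact Int.abs_lt_one_iff.1 (by exact_mod_cast this)
  simp [this]

lemma abs_eq_pi_of_coe_angle_eq_pi {r : ℝ} (h : (r : Real.Angle) = (π : ℝ))
    (hr : |r| < 3 * π) : |r| = π := by
  obtain ⟨k, hk⟩ := Real.Angle.angle_eq_iff_two_pi_dvd_sub.1 h
  have hpi := Real.pi_pos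
  rw [abs_lt] at hr
  have hk1 : (-2 : ℝ) < k := by nlinarith
  have hk2 : (k : ℝ) < 1 := by nlinarith
  have hk1' : -2 < k := by exact_mod_cast hk1
  have hk2' : k < 1 := by exact_mod_cast hk2
  obtain rfl | rfl : k = 0 ∨ k = -1 := by omega
  · have : r = π := by push_cast at hk; linarith
    rw [this, abs_of_pos hpi]
  · have : r = -π := by push_cast at hk; linarith
    rw [this, abs_neg, abs_of_pos hpi]

lemma segment_subset_left {a b c : ℂ} (h : c ∈ segment ℝ a b) :
    segment ℝ a c ⊆ segment ℝ a b :=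
  (convex_segment a b).segment_subset (left_mem_segment ℝ _ _) h

lemma arg_sub_coe {a b : ℂ} (h : a ≠ b) :
    (arg (a - b) : Real.Angle) = arg (b - a) + (π : Real.Angle) := by
  rw [← arg_neg_coe_angle (sub_ne_zero.2 h.symm), neg_sub]

/-- The direction from a moving point of one segment to a moving point of a disjoint segment
never degenerates, so its total turn around the square of parameters vanishes. -/
lemma viewAngle_square {a b c d : ℂ} (h : Disjoint (segment ℝ a b) (segment ℝ c d)) :
    viewAngle a c d - viewAngle b c d = viewAngle c a b - viewAngle d a b := by
  have hcon : IsPreconnected (segment ℝ a b) := (convex_segment a b).isPreconnected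
  have hdis : ∀ y ∈ segment ℝ a b, ∀ z ∈ segment ℝ c d, y ≠ z := fun y hy z hz hyz =>
    Set.disjoint_left.1 h hy (hyz ▸ hz)
  have hc := left_mem_segment ℝ c d
  have hd := right_mem_segment ℝ c d
  have ha := left_mem_segment ℝ a b
  have hb := right_mem_segment ℝ a b
  have key := eq_of_coe_angle_eq_zero hcon
    (f := fun y => viewAngle a c d - viewAngle y c d - (viewAngle c a y - viewAngle d a y))
    (fun y hy => ContinuousAt.continuousWithinAt ?_) (fun y hy => ?_) ha hb
  · simp only [viewAngle_self] at key
    linarith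
  · have h1 : y ∉ segment ℝ c d := fun h' => hdis y hy y h' rfl
    have h2 : c ∉ segment ℝ a y := fun h' => hdis c (segment_subset_left hy h') c hc rfl
    have h3 : d ∉ segment ℝ a y := fun h' => hdis d (segment_subset_left hy h') d hd rfl
    exact (continuousAt_const.sub
      (continuousAt_viewAngle continuousAt_id continuousAt_const continuousAt_const h1)).sub
      ((continuousAt_viewAngle continuousAt_const continuousAt_const continuousAt_id h2).sub
      (continuousAt_viewAngle continuousAt_const continuousAt_const continuousAt_id h3))
  · have h1 : y ∉ segment ℝ c d := fun h' => hdis y hy y h' rfl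
    have h0 : a ∉ segment ℝ c d := fun h' => hdis a ha a h' rfl
    have h2 : c ∉ segment ℝ a y := fun h' => hdis c (segment_subset_left hy h') c hc rfl
    have h3 : d ∉ segment ℝ a y := fun h' => hdis d (segment_subset_left hy h') d hd rfl
    simp only [Real.Angle.coe_sub, viewAngle_coe h0, viewAngle_coe h1, viewAngle_coe h2,
      viewAngle_coe h3, arg_sub_coe (hdis y hy c hc), arg_sub_coe (hdis y hy d hd),
      arg_sub_coe (hdis a ha c hc), arg_sub_coe (hdis a ha d hd)]
    abel

/-- The turning angle of the path `a, b, c` at `b`. -/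
noncomputable def turnAngle (a b c : ℂ) : ℝ := slitArg ((c - b) / (b - a))

/-- Two segments that only share the end point `b` do not fold back on each other. -/
lemma turn_mem_slitPlane {a b c : ℂ} (hab : a ≠ b) (hbc : b ≠ c)
    (h : segment ℝ a b ∩ segment ℝ b c = {b}) : (c - b) / (b - a) ∈ slitPlane := by
  have hba : b - a ≠ 0 := sub_ne_zero.2 hab.symm
  by_contra hq
  rw [mem_slitPlane_iff, not_or, not_lt, not_not] at hq
  obtain ⟨h1, h2⟩ := hq
  set q := (c - b) / (b - a) with hq
  have hqr : q = (q.re : ℂ) := by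
    apply Complex.ext <;> simp [h2]
  have hb : c = b + (q.re : ℂ) * (b - a) := by
    rw [← hqr, hq]; field_simp; ring
  generalize q.re = r at *
  have hr : r < 0 := by
    refine lt_of_le_of_ne h1 ?_
    rintro rfl
    apply hbc
    rw [hb]; simp
  -- a point of both segments other than `b`: go back from `b` by the smaller of the two lengths
  set s := min 1 (-r) with hs
  have hs0 : 0 < s := by rw [hs]; exact lt_min one_pos (by linarith)
  have hs1 : s ≤ 1 := min_le_left _ _
  have hs2 : s ≤ -r := min_le_right _ _
  have hmem : b - (s : ℂ) * (b - a) ∈ segment ℝ a b ∩ segment ℝ b c := by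
    constructor
    · refine ⟨s, 1 - s, hs0.le, by linarith, by ring, ?_⟩
      simp only [real_smul]; push_cast; ring
    · have h3 : 0 ≤ s / -r := div_nonneg hs0.le (by linarith)
      have h4 : s / -r ≤ 1 := (div_le_one (by linarith)).2 hs2
      refine ⟨1 - s / -r, s / -r, by linarith, h3, by ring, ?_⟩
      have hrc : (r : ℂ) ≠ 0 := by exact_mod_cast hr.ne
      rw [hb]
      simp only [real_smul]; push_cast; field_simp; ring
  rw [h, mem_singleton_iff, sub_eq_self] at hmem
  simp [hba, hs0.ne'] at hmem

lemma add_real_mem_slitPlane {z : ℂ} (hz : z ∈ slitPlane) {r : ℝ} (hr : 0 ≤ r) :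
    z + (r : ℂ) ∈ slitPlane := by
  rw [mem_slitPlane_iff] at *
  simp only [add_re, ofReal_re, add_im, ofReal_im, add_zero]
  rcases hz with hz | hz
  · left; linarith
  · right; exact hz

lemma slitPlane_inv {z : ℂ} (hz : z ∈ slitPlane) : z⁻¹ ∈ slitPlane := by
  rw [mem_slitPlane_iff_arg] at *
  refine ⟨?_, inv_ne_zero hz.2⟩
  rw [arg_inv, if_neg hz.1]
  have := neg_pi_lt_arg z
  intro h
  linarith

/-- The exterior angle of a triangle is the sum of the two opposite interior angles. -/
lemma slitArg_exterior {z : ℂ} (hz : z ∈ slitPlane) :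
    slitArg (1 + z) + slitArg (z / (1 + z)) = slitArg z := by
  have hz0 : z ≠ 0 := slitPlane_ne_zero hz
  -- deform `z / (1 + z)` through `z / (1 + s z)` for `0 ≤ s ≤ 1`
  have h1 : ∀ s ∈ Icc (0 : ℝ) 1, 1 + (s : ℂ) * z ∈ slitPlane := by
    intro s hs
    rcases hs.1.eq_or_lt with h | h
    · simp [← h]
    · have hsz : (s : ℂ) * z ∈ slitPlane := by
        rw [mem_slitPlane_iff, re_ofReal_mul, im_ofReal_mul] at *
        exact hz.imp (mul_pos h) (mul_ne_zero h.ne')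
      have := add_real_mem_slitPlane hsz zero_le_one
      rw [add_comm] at this
      simpa using this
  have h2 : ∀ s ∈ Icc (0 : ℝ) 1, z / (1 + (s : ℂ) * z) ∈ slitPlane := by
    intro s hs
    have := slitPlane_inv (add_real_mem_slitPlane (slitPlane_inv hz) hs.1)
    convert this using 1
    have := slitPlane_ne_zero (h1 s hs)
    have h3 : z⁻¹ + (s : ℂ) = (1 + s * z) / z := by field_simp
    rw [h3, inv_div]
  have key := eq_of_coe_angle_eq_zero (S := Icc (0 : ℝ) 1) isPreconnected_Icc
    (f := fun s : ℝ => slitArg (1 + (s : ℂ) * z) + slitArg (z / (1 + (s : ℂ) * z)) - slitArg z)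
    (fun s hs => ContinuousAt.continuousWithinAt ?_) (fun s hs => ?_)
    (left_mem_Icc.2 zero_le_one) (right_mem_Icc.2 zero_le_one)
  · simp at key
    have h0 : slitArg 1 = 0 := by simp [slitArg]
    linarith
  · refine ContinuousAt.sub (ContinuousAt.add ?_ ?_) continuousAt_const
    · exact ContinuousAt.comp (f := fun s : ℝ => 1 + (s : ℂ) * z) (continuousAt_slitArg (h1 s hs))
        (by fun_prop)
    · refine ContinuousAt.comp (f := fun s : ℝ => z / (1 + (s : ℂ) * z))
        (continuousAt_slitArg (h2 s hs)) ?_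
      exact continuousAt_const.div (by fun_prop) (slitPlane_ne_zero (h1 s hs))
  · rw [Real.Angle.coe_sub, Real.Angle.coe_add, slitArg_coe (h1 s hs), slitArg_coe (h2 s hs),
      slitArg_coe hz, arg_div_coe_angle hz0 (slitPlane_ne_zero (h1 s hs))]
    abel

/-- In the triangle `a, b, c` the interior angles at `a` and `c` add up to the exterior angle at
`b`. This replaces `viewAngle_square` for two consecutive edges. -/
lemma viewAngle_corner {a b c : ℂ} (hab : a ≠ b) (hbc : b ≠ c)
    (h : segment ℝ a b ∩ segment ℝ b c = {b}) :
    viewAngle a b c + viewAngle c a b = turnAngle a b c := by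
  have hz := turn_mem_slitPlane hab hbc h
  have hba : b - a ≠ 0 := sub_ne_zero.2 hab.symm
  rw [turnAngle, ← slitArg_exterior hz, viewAngle, viewAngle]
  have h1 : (c - a) / (b - a) = 1 + (c - b) / (b - a) := by field_simp; ring
  congr 2
  have h2 : 1 + (c - b) / (b - a) ≠ 0 := by
    have := add_real_mem_slitPlane hz zero_le_one
    rw [add_comm, ofReal_one] at this
    exact slitPlane_ne_zero this
  rw [← h1] at h2 ⊢
  have h3 : c - a ≠ 0 := fun h' => h2 (by simp [h'])
  rw [div_div_div_cancel_right₀ hba, ← neg_div_neg_eq, neg_sub, neg_sub]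

/-- Seen from the boundary of an open half-plane, angles between points of the half-plane are
differences of arguments measured from the inner normal. -/
lemma viewAngle_of_halfPlane {x a b h : ℂ} (ha : 0 < ((a - x) / h).re)
    (hb : 0 < ((b - x) / h).re) :
    viewAngle x a b = arg ((b - x) / h) - arg ((a - x) / h) := by
  have hh : h ≠ 0 := by rintro rfl; simp at ha
  have ha0 : (a - x) / h ≠ 0 := fun h0 => by simp [h0] at ha
  have hb0 : (b - x) / h ≠ 0 := fun h0 => by simp [h0] at hb
  have ha1 := abs_lt.1 (abs_arg_lt_pi_div_two_iff.2 (Or.inl ha))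
  have hb1 := abs_lt.1 (abs_arg_lt_pi_div_two_iff.2 (Or.inl hb))
  have e : (b - x) / (a - x) = ((b - x) / h) / ((a - x) / h) := by
    rw [div_div_div_cancel_right₀ hh]
  have harg : arg ((b - x) / (a - x)) = arg ((b - x) / h) - arg ((a - x) / h) := by
    rw [e]
    refine sub_eq_zero.1 (eq_zero_of_coe_angle_eq_zero ?_ ?_)
    · rw [Real.Angle.coe_sub, arg_div_coe_angle hb0 ha0, Real.Angle.coe_sub, sub_self]
    · have h1 := neg_pi_lt_arg ((b - x) / h / ((a - x) / h))
      have h2 := arg_le_pi ((b - x) / h / ((a - x) / h))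
      rw [abs_lt]
      constructor <;> linarith
  rw [viewAngle, slitArg, if_neg (by rw [harg]; linarith [ha1.1, hb1.2]), harg]

/-! ### Simple loops and the total turning -/

/-- The edge of a closed polygonal curve starting at its `i`-th vertex. -/
def edge {n : ℕ} (v : Fin n → ℂ) (i : Fin n) : Set ℂ := segment ℝ (v i) (v (finRotate n i))

/-- The vertices of a simple closed polygonal curve in the complex plane. -/
structure IsSimpleLoop {n : ℕ} (v : Fin n → ℂ) : Prop where
  three_le : 3 ≤ n
  injective : Function.Injective v
  adjacent : ∀ i : Fin n, edge v i ∩ edge v (finRotate n i) = {v (finRotate n i)}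
  nonadjacent : ∀ i j : Fin n, i ≠ j → j ≠ finRotate n i → i ≠ finRotate n j →
    Disjoint (edge v i) (edge v j)

/-- The total angle swept, seen from `x`, by a point running once around the closed polygonal
curve with vertices `v`: off the curve it is `2π` times the winding number. -/
noncomputable def sweep {n : ℕ} (v : Fin n → ℂ) (x : ℂ) : ℝ :=
  ∑ i, viewAngle x (v i) (v (finRotate n i))

/-- The turning angle of a closed polygonal curve at its `i`-th vertex. -/
noncomputable def turn {n : ℕ} (v : Fin n → ℂ) (i : Fin n) : ℝ :=
  turnAngle (v ((finRotate n).symm i)) (v i) (v (finRotate n i))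

lemma val_finRotate {n : ℕ} (i : Fin n) : (finRotate n i : ℕ) = (i + 1) % n := by
  cases n with
  | zero => exact i.elim0
  | succ n => simp [Fin.val_add]

lemma finRotate_ne {n : ℕ} (hn : 3 ≤ n) (i : Fin n) : finRotate n i ≠ i := by
  intro h
  have := congrArg Fin.val h
  rw [val_finRotate] at this
  have hi := i.isLt
  rcases Nat.lt_or_ge (i + 1) n with h1 | h1
  · rw [Nat.mod_eq_of_lt h1] at this; omega
  · have h2 : (i : ℕ) + 1 = n := by omega
    rw [h2, Nat.mod_self] at this; omega

lemma finRotate_finRotate_ne {n : ℕ} (hn : 3 ≤ n) (i : Fin n) :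
    finRotate n (finRotate n i) ≠ i := by
  intro h
  have := congrArg Fin.val h
  rw [val_finRotate, val_finRotate] at this
  have hi := i.isLt
  rcases Nat.lt_or_ge (i + 1) n with h1 | h1
  · rw [Nat.mod_eq_of_lt h1] at this
    rcases Nat.lt_or_ge (i + 1 + 1) n with h2 | h2
    · rw [Nat.mod_eq_of_lt h2] at this; omega
    · have h2 : (i : ℕ) + 1 + 1 = n := by omega
      rw [h2, Nat.mod_self] at this; omega
  · have h2 : (i : ℕ) + 1 = n := by omega
    rw [h2, Nat.mod_self, Nat.mod_eq_of_lt (by omega)] at this; omega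

lemma finRotate_ofNat {n : ℕ} [NeZero n] (k : ℕ) :
    finRotate n (Fin.ofNat n k) = Fin.ofNat n (k + 1) := by
  ext
  rw [val_finRotate]
  simp

lemma ofNat_inj_of_lt {n : ℕ} [NeZero n] {i j : ℕ} (hi : i < n) (hj : j < n) :
    Fin.ofNat n i = Fin.ofNat n j ↔ i = j := by
  rw [Fin.ext_iff, Fin.val_ofNat, Fin.val_ofNat, Nat.mod_eq_of_lt hi, Nat.mod_eq_of_lt hj]

lemma sum_eq_sum_range_ofNat {n : ℕ} [NeZero n] (f : Fin n → ℝ) :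
    ∑ i, f i = ∑ k ∈ Finset.range n, f (Fin.ofNat n k) := by
  rw [← Fin.sum_univ_eq_sum_range (fun k => f (Fin.ofNat n k))]
  exact Finset.sum_congr rfl fun i _ => by simp

lemma sum_finRotate {n : ℕ} (f : Fin n → ℝ) : ∑ i, f (finRotate n i) = ∑ i, f i :=
  Equiv.sum_comp (finRotate n) f

/-- Summation by columns over the triangle of index pairs `i < j < m`. -/
lemma sum_triangle_sub (f : ℕ → ℕ → ℝ) (m : ℕ) :
    ∑ j ∈ Finset.range m, ∑ i ∈ Finset.range j, (f j i - f (j + 1) i) =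
      ∑ i ∈ Finset.range m, f (i + 1) i - ∑ i ∈ Finset.range m, f m i := by
  induction m with
  | zero => simp
  | succ m ih =>
    rw [Finset.sum_range_succ, ih, Finset.sum_sub_distrib, Finset.sum_range_succ,
      Finset.sum_range_succ (fun i => f (m + 1) i)]
    ring

namespace IsSimpleLoop

variable {n : ℕ} {v : Fin n → ℂ}

lemma vertex_ne (hv : IsSimpleLoop v) (i : Fin n) : v i ≠ v (finRotate n i) := fun h =>
  finRotate_ne hv.three_le i (hv.injective h).symm

/-- The antisymmetric part of the variation, along edge `i`, of the angle subtended by edge `j`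
is supported on pairs of consecutive edges, where it is the turning angle. -/
lemma viewAngle_skew (hv : IsSimpleLoop v) (i j : Fin n) :
    (viewAngle (v i) (v j) (v (finRotate n j))
        - viewAngle (v (finRotate n i)) (v j) (v (finRotate n j)))
      - (viewAngle (v j) (v i) (v (finRotate n i))
        - viewAngle (v (finRotate n j)) (v i) (v (finRotate n i)))
      = (if j = finRotate n i then turn v j else 0)
        - (if i = finRotate n j then turn v i else 0) := by
  have hcorner : ∀ k, viewAngle (v k) (v (finRotate n k)) (v (finRotate n (finRotate n k)))
      + viewAngle (v (finRotate n (finRotate n k))) (v k) (v (finRotate n k))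
      = turn v (finRotate n k) := by
    intro k
    have := viewAngle_corner (hv.vertex_ne k) (hv.vertex_ne _) (hv.adjacent k)
    rwa [turn, Equiv.symm_apply_apply]
  by_cases h1 : j = finRotate n i
  · subst h1
    rw [if_pos rfl, if_neg (finRotate_finRotate_ne hv.three_le i).symm, ← hcorner]
    simp only [viewAngle_left, viewAngle_right]
    ring
  by_cases h2 : i = finRotate n j
  · subst h2
    rw [if_neg h1, if_pos rfl, ← hcorner]
    simp only [viewAngle_left, viewAngle_right]
    ring
  rw [if_neg h1, if_neg h2]
  by_cases h3 : i = j
  · subst h3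
    simp
  have := viewAngle_square (hv.nonadjacent i j h3 h1 h2)
  linarith

/-- Summing `viewAngle_skew` over `j`, where one of the two variations telescopes to `0`. -/
lemma sweep_add_turn_finRotate (hv : IsSimpleLoop v) (i : Fin n) :
    sweep v (v (finRotate n i)) + turn v (finRotate n i) = sweep v (v i) + turn v i := by
  have h := Finset.sum_congr (rfl : Finset.univ = Finset.univ)
    fun j (_ : j ∈ Finset.univ) => hv.viewAngle_skew i j
  have h2 : ∀ j, i = finRotate n j ↔ j = (finRotate n).symm i := fun j => by
    rw [Equiv.eq_symm_apply, eq_comm]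
  simp only [Finset.sum_sub_distrib, h2, Finset.sum_ite_eq', Finset.mem_univ, if_true] at h
  rw [sum_finRotate (fun j => viewAngle (v j) (v i) (v (finRotate n i)))] at h
  have h3 : ∑ j, (if j = finRotate n i then turn v j else 0) = turn v (finRotate n i) := by
    simp
  have h4 : ∑ j, (if j = (finRotate n).symm i then turn v i else 0) = turn v i := by
    simp
  unfold sweep
  linarith

lemma sweep_add_turn_const (hv : IsSimpleLoop v) (i j : Fin n) :
    sweep v (v i) + turn v i = sweep v (v j) + turn v j := by
  have : NeZero n := ⟨by have := hv.three_le; omega⟩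
  have key : ∀ k : ℕ, sweep v (v (Fin.ofNat n k)) + turn v (Fin.ofNat n k) =
      sweep v (v (Fin.ofNat n 0)) + turn v (Fin.ofNat n 0) := by
    intro k
    induction k with
    | zero => rfl
    | succ k ih => rw [← finRotate_ofNat, hv.sweep_add_turn_finRotate, ih]
  have hi := key i
  have hj := key j
  rw [Fin.ofNat_val_eq_self] at hi hj
  rw [hi, hj]

/-- A discrete version of Hopf's argument: summing the angle variations over the triangle of
pairs of edges `i < j` gives the total turning on the one hand, and twice the sum of the
angle swept around a vertex and the turning angle there on the other hand. -/
lemma sum_turn (hv : IsSimpleLoop v) (i₀ : Fin n) :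
    ∑ i, turn v i = 2 * (sweep v (v i₀) + turn v i₀) := by
  have hn := hv.three_le
  have : NeZero n := ⟨by omega⟩
  set u : ℕ → Fin n := Fin.ofNat n with hu
  have hun : u n = u 0 := by ext; simp [hu]
  rw [hv.sweep_add_turn_const i₀ (u 0)]
  set f : ℕ → ℕ → ℝ := fun k i => viewAngle (v (u k)) (v (u i)) (v (u (i + 1))) with hf
  have hdiag : ∀ i, f i i = 0 := fun i => by simp [hf]
  have hdiag' : ∀ i, f (i + 1) i = 0 := fun i => by simp [hf]
  have hsweep : ∑ i ∈ Finset.range n, f 0 i = sweep v (v (u 0)) := by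
    rw [sweep, sum_eq_sum_range_ofNat]
    exact Finset.sum_congr rfl fun i _ => by simp only [hf, hu, finRotate_ofNat]
  have hskew : ∀ i j, (f i j - f (i + 1) j) - (f j i - f (j + 1) i) =
      (if u j = u (i + 1) then turn v (u j) else 0)
        - (if u i = u (j + 1) then turn v (u i) else 0) := by
    intro i j
    have := hv.viewAngle_skew (u i) (u j)
    simpa only [hu, finRotate_ofNat] using this
  -- the left hand side, by telescoping in both directions
  have h1 : ∑ j ∈ Finset.range n, ∑ i ∈ Finset.range j,
      ((f i j - f (i + 1) j) - (f j i - f (j + 1) i)) = 2 * sweep v (v (u 0)) := by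
    simp only [Finset.sum_sub_distrib (f := fun i => f i _ - f (i + 1) _)]
    rw [Finset.sum_sub_distrib, sum_triangle_sub]
    simp only [Finset.sum_range_sub', hdiag, hdiag', sub_zero]
    have : ∀ i, f n i = f 0 i := fun i => by simp only [hf, hun]
    simp only [this, hsweep]
    simp
    ring
  have h2 : ∀ j ∈ Finset.range n, ∑ i ∈ Finset.range j,
      (if u j = u (i + 1) then turn v (u j) else 0) =
        turn v (u j) - if j = 0 then turn v (u 0) else 0 := by
    intro j hj
    rw [Finset.mem_range] at hj
    cases j with
    | zero => simp
    | succ k =>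
      have : ∀ i ∈ Finset.range (k + 1), (if u (k + 1) = u (i + 1) then turn v (u (k + 1)) else 0)
          = if i = k then turn v (u (k + 1)) else 0 := by
        intro i hi
        rw [Finset.mem_range] at hi
        exact if_congr ((ofNat_inj_of_lt hj (by omega)).trans (by omega)) rfl rfl
      rw [Finset.sum_congr rfl this]
      simp
  have h3 : ∀ j ∈ Finset.range n, ∑ i ∈ Finset.range j,
      (if u i = u (j + 1) then turn v (u i) else 0) = if j = n - 1 then turn v (u 0) else 0 := by
    intro j hj
    rw [Finset.mem_range] at hj
    split_ifs with hjn
    · have hj1 : j + 1 = n := by omega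
      have : ∀ i ∈ Finset.range j, (if u i = u (j + 1) then turn v (u i) else 0)
          = if i = 0 then turn v (u 0) else 0 := by
        intro i hi
        rw [Finset.mem_range] at hi
        rw [hj1, hun]
        by_cases h : i = 0
        · simp [h]
        · rw [if_neg h, if_neg (mt (ofNat_inj_of_lt (by omega) (by omega)).1 h)]
      rw [Finset.sum_congr rfl this]
      simp
      omega
    · refine Finset.sum_eq_zero fun i hi => ?_
      rw [Finset.mem_range] at hi
      exact if_neg (mt (ofNat_inj_of_lt (by omega) (by omega)).1 (by omega))
  simp only [hskew, Finset.sum_sub_distrib] at h1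
  rw [Finset.sum_congr rfl h2, Finset.sum_congr rfl h3, Finset.sum_sub_distrib,
    Finset.sum_ite_eq', Finset.sum_ite_eq', if_pos (Finset.mem_range.2 (by omega)),
    if_pos (Finset.mem_range.2 (by omega))] at h1
  rw [sum_eq_sum_range_ofNat (turn v)]
  linarith

/-- The angle swept around a vertex and the turning angle there add up to `π` or `-π`. This is
checked at a vertex farthest from the origin, from which all others lie in a half-plane. -/
lemma abs_sweep_add_turn (hv : IsSimpleLoop v) (i₀ : Fin n) :
    |sweep v (v i₀) + turn v i₀| = π := by
  have hn := hv.three_le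
  have : NeZero n := ⟨by omega⟩
  obtain ⟨m, hm⟩ := Finite.exists_max fun i => ‖v i‖
  rw [hv.sweep_add_turn_const i₀ m]
  have hm0 : v m ≠ 0 := by
    intro h0
    have h1 := hm (finRotate n m)
    rw [h0, norm_zero, norm_le_zero_iff] at h1
    exact hv.vertex_ne m (h0.trans h1.symm)
  have hpos : ∀ j, j ≠ m → 0 < ((v j - v m) / (-v m)).re := by
    intro j hj
    have e : (v j - v m) / (-v m) = 1 - v j / v m := by field_simp; ring
    have h1 : ‖v j / v m‖ ≤ 1 := by
      rw [norm_div]; exact (div_le_one (norm_pos_iff.2 hm0)).2 (hm j)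
    have h2 : v j / v m ≠ 1 := by
      intro h
      rw [div_eq_one_iff_eq hm0] at h
      exact hj (hv.injective h)
    rw [e, sub_re, one_re]
    by_contra! h3
    apply h2
    have h4 := sq_norm_sub_sq_re (v j / v m)
    have h5 : (v j / v m).re ≤ 1 := (re_le_norm _).trans h1
    have h6 : (v j / v m).re = 1 := by linarith
    have h7 : ‖v j / v m‖ ^ 2 ≤ 1 := by
      have := norm_nonneg (v j / v m); nlinarith
    apply Complex.ext
    · simpa using h6
    · rw [h6] at h4
      rw [one_im]
      nlinarith [sq_nonneg (v j / v m).im]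
  set θ : Fin n → ℝ := fun j => arg ((v j - v m) / (-v m)) with hθ
  have hθlt : ∀ j, j ≠ m → |θ j| < π / 2 := fun j hj =>
    abs_arg_lt_pi_div_two_iff.2 (Or.inl (hpos j hj))
  set p := (finRotate n).symm m with hp
  have hpm : finRotate n p = m := by simp [hp]
  have hpne : p ≠ m := fun h => finRotate_ne hn p (hpm.trans h.symm)
  have hsne : finRotate n m ≠ m := finRotate_ne hn m
  have hS : sweep v (v m) = θ p - θ (finRotate n m) := by
    have hterm : ∀ j, viewAngle (v m) (v j) (v (finRotate n j)) =
        (θ (finRotate n j) - θ j) - (if j = m then θ (finRotate n m) - θ m else 0)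
          - (if j = p then θ m - θ p else 0) := by
      intro j
      by_cases h1 : j = m
      · subst h1
        simp [hpne.symm]
      by_cases h2 : j = p
      · rw [h2, hpm]
        simp [hpne]
      · rw [if_neg h1, if_neg h2]
        have h3 : finRotate n j ≠ m := fun h => h2 (by rw [hp, ← h, Equiv.symm_apply_apply])
        rw [viewAngle_of_halfPlane (hpos j h1) (hpos _ h3)]
        simp [hθ]
    rw [sweep, Finset.sum_congr rfl fun j _ => hterm j, Finset.sum_sub_distrib,
      Finset.sum_sub_distrib, Finset.sum_sub_distrib, sum_finRotate θ]
    simp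
  have hplt := abs_lt.1 (hθlt p hpne)
  have hslt := abs_lt.1 (hθlt _ hsne)
  have hτ : |turn v m| < π := abs_slitArg_lt _
  have hpv : v p ≠ v m := fun h => hpne (hv.injective h)
  have hsv : v (finRotate n m) ≠ v m := fun h => hsne (hv.injective h)
  have hadj : segment ℝ (v p) (v m) ∩ segment ℝ (v m) (v (finRotate n m)) = {v m} := by
    have := hv.adjacent p
    rwa [edge, edge, hpm] at this
  have hangle : ((sweep v (v m) + turn v m : ℝ) : Real.Angle) = (π : ℝ) := by
    have hm0' := neg_ne_zero.2 hm0
    rw [Real.Angle.coe_add, hS, turn, turnAngle, ← hp,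
      slitArg_coe (turn_mem_slitPlane hpv hsv.symm hadj),
      arg_div_coe_angle (sub_ne_zero.2 hsv) (sub_ne_zero.2 hpv.symm), Real.Angle.coe_sub]
    simp only [hθ]
    rw [arg_div_coe_angle (sub_ne_zero.2 hsv) hm0', arg_div_coe_angle (sub_ne_zero.2 hpv) hm0',
      arg_sub_coe hpv]
    abel
  refine abs_eq_pi_of_coe_angle_eq_pi hangle ?_
  have hτ' := abs_lt.1 hτ
  rw [abs_lt]
  constructor <;> linarith

end IsSimpleLoop

/-- Half the total turning: it is `π` or `-π`, according to the orientation of the curve. -/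
noncomputable def halfTurning {n : ℕ} (v : Fin n → ℂ) : ℝ :=
  (∑ i, turn v i) / 2

lemma slitArg_real_mul {r : ℝ} (hr : 0 < r) (z : ℂ) : slitArg ((r : ℂ) * z) = slitArg z := by
  rw [slitArg, slitArg, arg_real_mul z hr]

namespace IsSimpleLoop

variable {n : ℕ} {v : Fin n → ℂ}

/-- On an open edge the swept angle is what it would be at a vertex without turning. -/
lemma sweep_of_mem_openSegment (hv : IsSimpleLoop v) {k : Fin n} {p : ℂ}
    (hp : p ∈ openSegment ℝ (v k) (v (finRotate n k))) :
    sweep v p = sweep v (v k) + turn v k := by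
  have hn := hv.three_le
  have hpe : p ∈ edge v k := openSegment_subset_segment ℝ _ _ hp
  have hsub : segment ℝ (v k) p ⊆ edge v k := segment_subset_left hpe
  obtain ⟨s, t, hs, ht, hst, rfl⟩ := hp
  set p := s • v k + t • v (finRotate n k) with hp
  have hk := hv.vertex_ne k
  have hp1 : p - v k = (t : ℂ) * (v (finRotate n k) - v k) := by
    have : (s : ℂ) = 1 - t := by rw [eq_sub_iff_add_eq]; exact_mod_cast hst
    simp only [hp, real_smul, this]; ring
  have hp2 : p - v (finRotate n k) = (s : ℂ) * (v k - v (finRotate n k)) := by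
    have : (t : ℂ) = 1 - s := by rw [eq_sub_iff_add_eq']; exact_mod_cast hst
    simp only [hp, real_smul, this]; ring
  have hpk : v k ≠ p := by
    intro h
    rw [← h, sub_self, eq_comm, mul_eq_zero, sub_eq_zero] at hp1
    rcases hp1 with h | h
    · exact ht.ne' (by exact_mod_cast h)
    · exact hk h.symm
  have hfar : viewAngle (v (finRotate n k)) (v k) p = 0 := by
    rw [viewAngle, hp2, mul_div_assoc, slitArg_real_mul hs, div_self (sub_ne_zero.2 hk)]
    simp [slitArg]
  have hfar' : v (finRotate n k) ∉ segment ℝ (v k) p := by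
    rw [notMem_segment_iff, hp2, mul_div_assoc, div_self (sub_ne_zero.2 hk), mul_one]
    exact ofReal_mem_slitPlane.2 hs
  -- exchange the roles of edge `i` and the initial piece of edge `k` up to `p`
  have hterm : ∀ i, viewAngle (v k) (v i) (v (finRotate n i))
      - viewAngle p (v i) (v (finRotate n i)) =
      viewAngle (v i) (v k) p - viewAngle (v (finRotate n i)) (v k) p
        - if finRotate n i = k then turn v k else 0 := by
    intro i
    by_cases h1 : i = k
    · subst h1
      rw [if_neg (finRotate_ne hn i), hfar, viewAngle_of_mem hpe]
      simp
    by_cases h2 : finRotate n i = k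
    · rw [if_pos h2, h2]
      have hik : v i ≠ v k := fun h => h1 (hv.injective h)
      have hadj : segment ℝ (v i) (v k) ∩ segment ℝ (v k) p = {v k} := by
        apply Subset.antisymm
        · have := hv.adjacent i
          rw [h2] at this
          rw [← this, edge, h2]
          exact inter_subset_inter_right _ hsub
        · rintro _ rfl
          exact ⟨right_mem_segment ℝ _ _, left_mem_segment ℝ _ _⟩
      have hc := viewAngle_corner hik hpk hadj
      have ht' : turnAngle (v i) (v k) p = turn v k := by
        rw [turnAngle, hp1, mul_div_assoc, slitArg_real_mul ht, turn, turnAngle,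
          (Equiv.symm_apply_eq _).2 h2.symm]
      rw [ht'] at hc
      simp only [viewAngle_left, viewAngle_right]
      linarith
    · rw [if_neg h2, sub_zero]
      refine viewAngle_square ?_
      by_cases h3 : i = finRotate n k
      · rw [Set.disjoint_left]
        intro y hy hy'
        have : y ∈ edge v k ∩ edge v (finRotate n k) := ⟨hsub hy, by rwa [h3] at hy'⟩
        rw [hv.adjacent, mem_singleton_iff] at this
        rw [this] at hy
        exact hfar' hy
      · exact (hv.nonadjacent k i (Ne.symm h1) h3 (Ne.symm h2)).mono_left hsub
  have hsum := Finset.sum_congr (rfl : Finset.univ = Finset.univ)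
    fun i (_ : i ∈ Finset.univ) => hterm i
  rw [Finset.sum_sub_distrib, Finset.sum_sub_distrib, Finset.sum_sub_distrib,
    sum_finRotate (fun i => viewAngle (v i) (v k) p)] at hsum
  have h4 : ∑ i, (if finRotate n i = k then turn v k else 0) = turn v k := by
    rw [sum_finRotate (fun i => if i = k then turn v k else 0)]
    simp
  rw [h4] at hsum
  unfold sweep
  linarith

lemma sweep_vertex (hv : IsSimpleLoop v) (k : Fin n) :
    sweep v (v k) = halfTurning v - turn v k := by
  rw [halfTurning, hv.sum_turn k]
  ring

lemma abs_halfTurning (hv : IsSimpleLoop v) : |halfTurning v| = π := by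
  have hn := hv.three_le
  rw [← hv.abs_sweep_add_turn ⟨0, by omega⟩, hv.sweep_vertex, sub_add_cancel]

lemma sweep_openSegment (hv : IsSimpleLoop v) {k : Fin n} {p : ℂ}
    (hp : p ∈ openSegment ℝ (v k) (v (finRotate n k))) : sweep v p = halfTurning v := by
  rw [hv.sweep_of_mem_openSegment hp, hv.sweep_vertex, sub_add_cancel]

end IsSimpleLoop

/-! ### The swept angle off and near the curve -/

/-- The closed polygonal curve with vertices `v`. -/
def curve {n : ℕ} (v : Fin n → ℂ) : Set ℂ := ⋃ i, edge v i

section Sweep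

variable {n : ℕ} {v : Fin n → ℂ}

lemma isClosed_edge (v : Fin n → ℂ) (i : Fin n) : IsClosed (edge v i) := by
  rw [edge, ← convexHull_pair]
  exact ((Set.toFinite {v i, v (finRotate n i)}).isCompact_convexHull ℝ).isClosed

lemma isCompact_curve (v : Fin n → ℂ) : IsCompact (curve v) := by
  refine isCompact_iUnion fun i => ?_
  rw [edge, ← convexHull_pair]
  exact (Set.toFinite {v i, v (finRotate n i)}).isCompact_convexHull ℝ

lemma isOpen_compl_curve (v : Fin n → ℂ) : IsOpen (curve v)ᶜ :=
  (isCompact_curve v).isClosed.isOpen_compl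

lemma notMem_edge {x : ℂ} (hx : x ∉ curve v) (i : Fin n) : x ∉ edge v i := fun h =>
  hx (mem_iUnion.2 ⟨i, h⟩)

lemma sweep_coe (hx : x ∉ curve v) : (sweep v x : Real.Angle) = 0 := by
  have h : (sweep v x : Real.Angle) =
      ∑ i, ((viewAngle x (v i) (v (finRotate n i)) : ℝ) : Real.Angle) :=
    map_sum Real.Angle.coeHom _ _
  rw [h, Finset.sum_congr rfl fun i _ => viewAngle_coe (notMem_edge hx i),
    Finset.sum_sub_distrib,
    Equiv.sum_comp (finRotate n) (fun i => (arg (v i - x) : Real.Angle)), sub_self]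

lemma continuousAt_sweep {x : ℂ} (hx : x ∉ curve v) : ContinuousAt (sweep v) x := by
  unfold sweep
  refine tendsto_finsetSum _ fun i _ => ?_
  exact continuousAt_viewAngle continuousAt_id continuousAt_const continuousAt_const
    (notMem_edge hx i)

lemma sweep_eq_of_isPreconnected {S : Set ℂ} (hS : IsPreconnected S) (hSv : S ⊆ (curve v)ᶜ)
    {x y : ℂ} (hx : x ∈ S) (hy : y ∈ S) : sweep v x = sweep v y :=
  eq_of_coe_angle_eq_zero hS
    (fun _ hz => (continuousAt_sweep (hSv hz)).continuousWithinAt)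
    (fun _ hz => sweep_coe (hSv hz)) hx hy

lemma sweep_of_halfPlane {x h : ℂ} (hh : ∀ i, 0 < ((v i - x) / h).re) : sweep v x = 0 := by
  rw [sweep, Finset.sum_congr rfl fun i _ => viewAngle_of_halfPlane (hh i) (hh _),
    Finset.sum_sub_distrib, sum_finRotate (fun i => arg ((v i - x) / h)), sub_self]

lemma exists_sweep_eq_zero (v : Fin n → ℂ) : ∃ R : ℝ, ∀ x : ℂ, R < ‖x‖ → sweep v x = 0 := by
  refine ⟨∑ i, ‖v i‖, fun x hx => sweep_of_halfPlane (h := -x) fun i => ?_⟩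
  have h1 : ‖v i‖ < ‖x‖ :=
    (Finset.single_le_sum (f := fun i => ‖v i‖) (fun _ _ => norm_nonneg _)
      (Finset.mem_univ i)).trans_lt hx
  have hx0 : 0 < ‖x‖ := (norm_nonneg _).trans_lt h1
  have hx0' : x ≠ 0 := norm_pos_iff.1 hx0
  have e : (v i - x) / (-x) = 1 - v i / x := by field_simp; ring
  have h2 : ‖v i / x‖ < 1 := by rw [norm_div]; exact (div_lt_one hx0).2 h1
  have h3 := (re_le_norm (v i / x)).trans_lt h2
  rw [e, sub_re, one_re]
  linarith

lemma measurable_sweep (v : Fin n → ℂ) : Measurable (sweep v) :=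
  Finset.measurable_fun_sum _ fun _ _ => measurable_viewAngle _ _

lemma abs_sweep_le (v : Fin n → ℂ) (x : ℂ) : |sweep v x| ≤ n * π := by
  refine (Finset.abs_sum_le_sum_abs _ _).trans ?_
  refine (Finset.sum_le_sum fun _ _ => (abs_viewAngle_lt _ _ _).le).trans ?_
  simp

/-- The part of the swept angle contributed by the edges away from `p` depends continuously on
the point of view near `p`. -/
lemma eventually_abs_sweep_sub_lt (v : Fin n → ℂ) (p : ℂ) {δ : ℝ} (hδ : 0 < δ) :
    ∀ᶠ x in 𝓝 p, |sweep v x - sweep v p -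
      ∑ i, (open Classical in if p ∈ edge v i then viewAngle x (v i) (v (finRotate n i)) else 0)|
        < δ := by
  classical
  set g : ℂ → ℝ := fun x => ∑ i, if p ∈ edge v i then 0 else viewAngle x (v i) (v (finRotate n i))
    with hg
  have hgc : ContinuousAt g p := by
    refine tendsto_finsetSum _ fun i _ => ?_
    by_cases h : p ∈ edge v i
    · simp [h]
    · simp only [h, if_false]
      exact continuousAt_viewAngle continuousAt_id continuousAt_const continuousAt_const h
  have hgp : g p = sweep v p := by
    refine Finset.sum_congr rfl fun i _ => ?_
    split_ifs with h
    · exact (viewAngle_of_mem h).symm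
    · rfl
  filter_upwards [Metric.tendsto_nhds.1 hgc δ hδ] with x hx
  rw [Real.dist_eq, hgp] at hx
  convert hx using 2
  have : sweep v x = g x +
      ∑ i, (if p ∈ edge v i then viewAngle x (v i) (v (finRotate n i)) else 0) := by
    rw [hg, sweep, ← Finset.sum_add_distrib]
    refine Finset.sum_congr rfl fun i _ => ?_
    split_ifs <;> simp
  rw [this]
  simp only [Finset.sum_ite, Finset.sum_const_zero]
  ring

lemma exists_of_mem_curve {p : ℂ} (hp : p ∈ curve v) :
    (∃ k, p = v k) ∨ ∃ k, p ∈ openSegment ℝ (v k) (v (finRotate n k)) := by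
  obtain ⟨k, hk⟩ := mem_iUnion.1 hp
  rw [edge, ← insert_endpoints_openSegment, mem_insert_iff, mem_insert_iff] at hk
  rcases hk with h | h | h
  · exact Or.inl ⟨_, h⟩
  · exact Or.inl ⟨_, h⟩
  · exact Or.inr ⟨k, h⟩

end Sweep

namespace IsSimpleLoop

variable {n : ℕ} {v : Fin n → ℂ}

lemma eq_or_eq_of_vertex_mem (hv : IsSimpleLoop v) {i k : Fin n} (h : v k ∈ edge v i) :
    i = k ∨ finRotate n i = k := by
  by_contra! h'
  have hk : v k ∈ edge v k := left_mem_segment ℝ _ _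
  by_cases h3 : i = finRotate n k
  · subst h3
    have : v k ∈ ({v (finRotate n k)} : Set ℂ) := hv.adjacent k ▸ ⟨hk, h⟩
    exact hv.vertex_ne k this
  · exact Set.disjoint_left.1 (hv.nonadjacent k i h'.1.symm h3 h'.2.symm) hk h

lemma eq_of_openSegment_mem (hv : IsSimpleLoop v) {i k : Fin n} {p : ℂ}
    (hp : p ∈ openSegment ℝ (v k) (v (finRotate n k))) (h : p ∈ edge v i) : i = k := by
  by_contra h1
  have hk : p ∈ edge v k := openSegment_subset_segment ℝ _ _ hp
  by_cases h3 : i = finRotate n k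
  · subst h3
    have : p ∈ ({v (finRotate n k)} : Set ℂ) := hv.adjacent k ▸ ⟨hk, h⟩
    rw [mem_singleton_iff] at this
    rw [this, right_mem_openSegment_iff] at hp
    exact hv.vertex_ne k hp
  by_cases h4 : k = finRotate n i
  · subst h4
    have : p ∈ ({v (finRotate n i)} : Set ℂ) := hv.adjacent i ▸ ⟨h, hk⟩
    rw [mem_singleton_iff] at this
    rw [this, left_mem_openSegment_iff] at hp
    exact hv.vertex_ne _ hp
  · exact Set.disjoint_left.1 (hv.nonadjacent k i (Ne.symm h1) h3 h4) hk h

lemma coe_halfTurning (hv : IsSimpleLoop v) : (halfTurning v : Real.Angle) = (π : ℝ) := by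
  rcases (abs_eq Real.pi_pos.le).1 hv.abs_halfTurning with h | h
  · rw [h]
  · rw [h, Real.Angle.coe_neg, Real.Angle.neg_coe_pi]

/-- Near a point of the curve and off the curve, the swept angle only takes the two values
`0` and `2 * halfTurning v`. -/
lemma eventually_abs_sweep_sub (hv : IsSimpleLoop v) {p : ℂ} (hp : p ∈ curve v) :
    ∀ᶠ x in 𝓝 p, x ∉ curve v → |sweep v x - halfTurning v| = π := by
  classical
  have hn := hv.three_le
  have hpi := Real.pi_pos
  have hreduce : ∀ x, x ∉ curve v → |sweep v x - halfTurning v| < 3 * π →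
      |sweep v x - halfTurning v| = π := fun x hx h => by
    refine abs_eq_pi_of_coe_angle_eq_pi ?_ h
    rw [Real.Angle.coe_sub, sweep_coe hx, hv.coe_halfTurning, zero_sub, Real.Angle.neg_coe_pi]
  rcases exists_of_mem_curve hp with ⟨k, rfl⟩ | ⟨k, hk⟩
  · have hτ : |turn v k| < π := abs_slitArg_lt _
    filter_upwards [eventually_abs_sweep_sub_lt v (v k) (sub_pos.2 hτ)] with x hx hxc
    refine hreduce x hxc ?_
    have hsum : ∑ i, (if v k ∈ edge v i then viewAngle x (v i) (v (finRotate n i)) else 0) =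
        viewAngle x (v k) (v (finRotate n k)) +
          viewAngle x (v ((finRotate n).symm k)) (v k) := by
      have hmem : ∀ i, v k ∈ edge v i ↔ i = k ∨ i = (finRotate n).symm k := fun i => by
        rw [Equiv.eq_symm_apply]
        refine ⟨hv.eq_or_eq_of_vertex_mem, ?_⟩
        rintro (rfl | rfl)
        · exact left_mem_segment ℝ _ _
        · exact right_mem_segment ℝ _ _
      have hne : k ≠ (finRotate n).symm k := by
        rw [Ne, Equiv.eq_symm_apply]
        exact finRotate_ne hn k
      simp only [hmem]
      rw [← Finset.sum_filter, Finset.filter_or, Finset.filter_eq', Finset.filter_eq',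
        if_pos (Finset.mem_univ _), if_pos (Finset.mem_univ _), ← Finset.insert_eq,
        Finset.sum_pair hne, Equiv.apply_symm_apply]
    have h1 := abs_lt.1 (abs_viewAngle_lt x (v k) (v (finRotate n k)))
    have h2 := abs_lt.1 (abs_viewAngle_lt x (v ((finRotate n).symm k)) (v k))
    have h3 := neg_abs_le (turn v k)
    have h4 := le_abs_self (turn v k)
    rw [hsum, hv.sweep_vertex, abs_lt] at hx
    rw [abs_lt]
    constructor <;> linarith [hx.1, hx.2, h1.1, h1.2, h2.1, h2.2]
  · filter_upwards [eventually_abs_sweep_sub_lt v p hpi] with x hx hxc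
    refine hreduce x hxc ?_
    have hmem : ∀ i, p ∈ edge v i ↔ i = k := fun i =>
      ⟨hv.eq_of_openSegment_mem hk, fun h => h ▸ openSegment_subset_segment ℝ _ _ hk⟩
    simp only [hmem, Finset.sum_ite_eq', Finset.mem_univ, if_true] at hx
    have h1 := abs_lt.1 (abs_viewAngle_lt x (v k) (v (finRotate n k)))
    rw [hv.sweep_openSegment hk, abs_lt] at hx
    rw [abs_lt]
    constructor <;> linarith [hx.1, hx.2, h1.1, h1.2]

/-- The two sides of an open edge: crossing it changes the swept angle from
`halfTurning v - π` to `halfTurning v + π`. -/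
lemma eventually_sweep_side (hv : IsSimpleLoop v) {k : Fin n} {p : ℂ}
    (hp : p ∈ openSegment ℝ (v k) (v (finRotate n k))) :
    ∀ᶠ ε : ℝ in 𝓝 0,
      (0 < ε → p + (ε : ℂ) * (I * (v (finRotate n k) - v k)) ∉ curve v ∧
        sweep v (p + (ε : ℂ) * (I * (v (finRotate n k) - v k))) = halfTurning v + π) ∧
      (ε < 0 → p + (ε : ℂ) * (I * (v (finRotate n k) - v k)) ∉ curve v ∧
        sweep v (p + (ε : ℂ) * (I * (v (finRotate n k) - v k))) = halfTurning v - π) := by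
  classical
  have hpi := Real.pi_pos
  have hmem : ∀ i, p ∈ edge v i ↔ i = k := fun i =>
    ⟨hv.eq_of_openSegment_mem hp, fun h => h ▸ openSegment_subset_segment ℝ _ _ hp⟩
  have hpc : p ∈ curve v := mem_iUnion.2 ⟨k, (hmem k).2 rfl⟩
  have hlim : Tendsto (fun ε : ℝ => p + (ε : ℂ) * (I * (v (finRotate n k) - v k)))
      (𝓝 0) (𝓝 p) := by
    have : Continuous fun ε : ℝ => p + (ε : ℂ) * (I * (v (finRotate n k) - v k)) := by fun_prop
    simpa using this.tendsto 0
  have hother : ∀ᶠ x in 𝓝 p, ∀ i, i ≠ k → x ∉ edge v i := by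
    refine eventually_all.2 fun i => ?_
    by_cases h : i = k
    · simp [h]
    · filter_upwards [(isClosed_edge v i).isOpen_compl.mem_nhds fun h' => h ((hmem i).1 h')]
        with x hx _
      exact hx
  have hsw := eventually_abs_sweep_sub_lt v p hpi
  simp only [hmem, Finset.sum_ite_eq', Finset.mem_univ, if_true, hv.sweep_openSegment hp] at hsw
  filter_upwards [hlim.eventually hother, hlim.eventually hsw,
    hlim.eventually (hv.eventually_abs_sweep_sub hpc)] with ε h1 h2 h3
  have hU := sub_ne_zero.2 (hv.vertex_ne k).symm
  set x := p + (ε : ℂ) * (I * (v (finRotate n k) - v k)) with hx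
  obtain ⟨s, t, hs, ht, hst, hp'⟩ := hp
  set U := v (finRotate n k) - v k with hUdef
  have hc : (s : ℂ) = 1 - t := by rw [eq_sub_iff_add_eq]; exact_mod_cast hst
  have e1 : v (finRotate n k) - x = ((s : ℂ) - ε * I) * U := by
    rw [hx, ← hp', hUdef]; simp only [real_smul, hc]; ring
  have e2 : v k - x = (-(t : ℂ) - ε * I) * U := by
    rw [hx, ← hp', hUdef]; simp only [real_smul, hc]; ring
  have hD : 0 < t ^ 2 + ε ^ 2 := by positivity
  have him : ((v (finRotate n k) - x) / (v k - x)).im = ε / (t ^ 2 + ε ^ 2) := by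
    rw [e1, e2, mul_div_mul_right _ _ hU, div_im]
    simp [normSq_apply]
    rw [← sub_div]
    have : t * t + ε * ε = t ^ 2 + ε ^ 2 := by ring
    rw [this]
    congr 1
    linear_combination ε * hst
  have hoff : ε ≠ 0 → x ∉ curve v := by
    intro hε hxc
    obtain ⟨i, hi⟩ := mem_iUnion.1 hxc
    by_cases h : i = k
    · subst h
      refine notMem_segment_iff.2 ?_ hi
      rw [mem_slitPlane_iff, him]
      exact Or.inr (div_ne_zero hε hD.ne')
    · exact h1 i h hi
  have hview : ε ≠ 0 → viewAngle x (v k) (v (finRotate n k)) =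
      arg ((v (finRotate n k) - x) / (v k - x)) := by
    intro hε
    refine slitArg_of_mem ?_
    rw [mem_slitPlane_iff, him]
    exact Or.inr (div_ne_zero hε hD.ne')
  rw [abs_lt] at h2
  constructor
  · intro hε
    refine ⟨hoff hε.ne', ?_⟩
    have h4 : 0 ≤ viewAngle x (v k) (v (finRotate n k)) := by
      rw [hview hε.ne', arg_nonneg_iff, him]
      positivity
    rcases (abs_eq hpi.le).1 (h3 (hoff hε.ne')) with h5 | h5 <;> linarith [h2.1, h2.2]
  · intro hε
    refine ⟨hoff hε.ne, ?_⟩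
    have h4 : viewAngle x (v k) (v (finRotate n k)) < 0 := by
      rw [hview hε.ne, arg_neg_iff, him]
      exact div_neg_of_neg_of_pos hε hD
    rcases (abs_eq hpi.le).1 (h3 (hoff hε.ne)) with h5 | h5 <;> linarith [h2.1, h2.2]

lemma mem_closure_sweep_openSegment (hv : IsSimpleLoop v) {k : Fin n} {p : ℂ}
    (hp : p ∈ openSegment ℝ (v k) (v (finRotate n k))) :
    p ∈ closure {x | x ∉ curve v ∧ sweep v x = 0} ∧
      p ∈ closure {x | x ∉ curve v ∧ sweep v x = 2 * halfTurning v} := by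
  have hlim : Tendsto (fun ε : ℝ => p + (ε : ℂ) * (I * (v (finRotate n k) - v k)))
      (𝓝 0) (𝓝 p) := by
    have : Continuous fun ε : ℝ => p + (ε : ℂ) * (I * (v (finRotate n k) - v k)) := by fun_prop
    simpa using this.tendsto 0
  have hplus : p ∈ closure {x | x ∉ curve v ∧ sweep v x = halfTurning v + π} := by
    refine mem_closure_of_tendsto (hlim.mono_left (nhdsWithin_le_nhds (s := Ioi 0))) ?_
    filter_upwards [nhdsWithin_le_nhds (hv.eventually_sweep_side hp), self_mem_nhdsWithin]
      with ε h1 h2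
    exact h1.1 h2
  have hminus : p ∈ closure {x | x ∉ curve v ∧ sweep v x = halfTurning v - π} := by
    refine mem_closure_of_tendsto (hlim.mono_left (nhdsWithin_le_nhds (s := Iio 0))) ?_
    filter_upwards [nhdsWithin_le_nhds (hv.eventually_sweep_side hp), self_mem_nhdsWithin]
      with ε h1 h2
    exact h1.2 h2
  rcases (abs_eq Real.pi_pos.le).1 hv.abs_halfTurning with h | h
  · rw [h] at hplus hminus ⊢
    rw [sub_self] at hminus
    rw [two_mul]
    exact ⟨hminus, hplus⟩
  · rw [h] at hplus hminus ⊢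
    rw [neg_add_cancel] at hplus
    rw [two_mul]
    exact ⟨hplus, hminus⟩

/-- Both values of the swept angle off the curve occur arbitrarily close to each point of the curve;
vertices are limits of points of open edges. -/
lemma mem_closure_sweep (hv : IsSimpleLoop v) {p : ℂ} (hp : p ∈ curve v) :
    p ∈ closure {x | x ∉ curve v ∧ sweep v x = 0} ∧
      p ∈ closure {x | x ∉ curve v ∧ sweep v x = 2 * halfTurning v} := by
  obtain ⟨k, hk⟩ := mem_iUnion.1 hp
  have hsub : p ∈ closure (openSegment ℝ (v k) (v (finRotate n k))) :=
    segment_subset_closure_openSegment hk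
  exact ⟨closure_minimal (fun _ h => (hv.mem_closure_sweep_openSegment h).1) isClosed_closure hsub,
    closure_minimal (fun _ h => (hv.mem_closure_sweep_openSegment h).2) isClosed_closure hsub⟩

end IsSimpleLoop

/-! ### Sectors, and the inside of a simple loop -/

lemma im_add_smul_sub_div (a b : ℝ) (hab : a + b = 1) (x y p u : ℂ) :
    ((a • x + b • y - p) / u).im = a * ((x - p) / u).im + b * ((y - p) / u).im := by
  have : (a • x + b • y - p) / u = (a : ℂ) * ((x - p) / u) + (b : ℂ) * ((y - p) / u) := by
    have hb : (b : ℂ) = 1 - a := by rw [eq_sub_iff_add_eq']; exact_mod_cast hab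
    simp only [real_smul, hb]; ring
  rw [this, add_im, im_ofReal_mul, im_ofReal_mul]

lemma convex_im_pos (p u : ℂ) : Convex ℝ {x | 0 < ((x - p) / u).im} := by
  intro x hx y hy a b ha hb hab
  simp only [mem_ofPred_eq] at *
  rw [im_add_smul_sub_div a b hab]
  rcases ha.eq_or_lt with h | h
  · have : b = 1 := by linarith
    simpa [← h, this] using hy
  · have := mul_pos h hx
    have := mul_nonneg hb hy.le
    linarith

lemma convex_im_neg (p u : ℂ) : Convex ℝ {x | ((x - p) / u).im < 0} := by
  have : {x | ((x - p) / u).im < 0} = {x | 0 < ((x - p) / (-u)).im} := by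
    ext x
    simp [div_neg]
  rw [this]
  exact convex_im_pos p (-u)

/-- Two distinct rays from `p` cut a disc around `p` into two preconnected sectors. Here the
second ray is at a counterclockwise angle of at most `π` from the first one, so that one sector is
an intersection, and the other a union, of two open half-discs. -/
lemma exists_sectors_of_im_nonneg {p u w : ℂ} (hu : u ≠ 0) (hw : -(w / u) ∈ slitPlane)
    (him : 0 ≤ (w / u).im) {r : ℝ} (hr : 0 < r) :
    ∃ A B : Set ℂ, IsPreconnected A ∧ IsPreconnected B ∧
      Metric.ball p r \ {x | ∃ t : ℝ, 0 ≤ t ∧ (x = p + t * u ∨ x = p + t * w)} = A ∪ B := by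
  set q := w / u with hq
  have hwq : w = q * u := by rw [hq]; field_simp
  have hq0 : q ≠ 0 := by
    intro h
    rw [h, neg_zero] at hw
    exact zero_notMem_slitPlane hw
  have hqneg : q.im = 0 → q.re < 0 := by
    intro h
    rw [mem_slitPlane_iff] at hw
    simpa [h] using hw
  have hN : 0 < normSq q := normSq_pos.2 hq0
  have hdw : ∀ x : ℂ, (x - p) / w = ((x - p) / u) / q := fun x => by
    rw [hwq, div_div, mul_comm q u]
  have hball := convex_ball p r
  refine ⟨Metric.ball p r ∩ ({x | 0 < ((x - p) / u).im} ∩ {x | ((x - p) / w).im < 0}),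
    (Metric.ball p r ∩ {x | ((x - p) / u).im < 0}) ∪ (Metric.ball p r ∩ {x | 0 < ((x - p) / w).im}),
    (hball.inter ((convex_im_pos p u).inter (convex_im_neg p w))).isPreconnected, ?_, ?_⟩
  · -- a direction `z * u` pointing away from the other sector
    obtain ⟨z, hz1, hz2⟩ : ∃ z : ℂ, z.im < 0 ∧ 0 < (z / q).im := by
      rcases him.eq_or_lt with h | h
      · refine ⟨-I, by simp, ?_⟩
        rw [div_im]
        have := hqneg h.symm
        simp only [neg_im, I_im, neg_re, I_re, neg_zero, zero_mul, zero_div, sub_zero]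
        exact div_pos (by linarith) hN
      · refine ⟨-(1 + q), by simpa using h, ?_⟩
        rw [div_im]
        simp only [neg_im, add_im, one_im, zero_add, neg_re, add_re, one_re]
        rw [← sub_div]
        exact div_pos (by linarith) hN
    have hz0 : z ≠ 0 := by rintro rfl; simp at hz1
    have hzu : 0 < ‖z * u‖ := norm_pos_iff.2 (mul_ne_zero hz0 hu)
    set ε : ℝ := r / 2 / ‖z * u‖ with hε
    have hε0 : 0 < ε := by positivity
    have hmem : p + (ε : ℂ) * (z * u) ∈ Metric.ball p r := by
      rw [mem_ball_iff_norm, add_sub_cancel_left, norm_mul, norm_real, Real.norm_of_nonneg hε0.le,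
        hε, div_mul_cancel₀ _ hzu.ne']
      linarith
    have hdu : (p + (ε : ℂ) * (z * u) - p) / u = (ε : ℂ) * z := by
      field_simp; ring
    refine IsPreconnected.union (p + (ε : ℂ) * (z * u)) ⟨hmem, ?_⟩ ⟨hmem, ?_⟩
      (hball.inter (convex_im_neg p u)).isPreconnected
      (hball.inter (convex_im_pos p w)).isPreconnected
    · rw [mem_ofPred_eq, hdu, im_ofReal_mul]
      exact mul_neg_of_pos_of_neg hε0 hz1
    · rw [mem_ofPred_eq, hdw, hdu, mul_div_assoc, im_ofReal_mul]
      exact mul_pos hε0 hz2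
  · ext x
    simp only [Set.mem_sdiff, mem_union, mem_inter_iff, mem_ofPred_eq, hdw]
    set z := (x - p) / u with hz
    have hxz : x = p + z * u := by rw [hz]; field_simp; ring
    have hray : (∃ t : ℝ, 0 ≤ t ∧ (x = p + t * u ∨ x = p + t * w)) ↔
        ∃ t : ℝ, 0 ≤ t ∧ (z = t ∨ z = t * q) := by
      refine exists_congr fun t => and_congr_right fun _ => or_congr ?_ ?_
      · rw [hxz, add_right_inj, mul_left_inj' hu]
      · rw [hxz, add_right_inj, hwq, ← mul_assoc, mul_left_inj' hu]
    rw [hray]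
    suffices (∃ t : ℝ, 0 ≤ t ∧ (z = t ∨ z = t * q)) ↔
        ¬ ((0 < z.im ∧ (z / q).im < 0) ∨ z.im < 0 ∨ 0 < (z / q).im) by
      rw [this, not_not, and_or_left, and_or_left]
    have hrq : ∀ t : ℝ, ((t : ℂ) / q).im = -(t * q.im) / normSq q := by
      intro t
      rw [div_im]
      simp
      ring
    constructor
    · rintro ⟨t, ht, h | h⟩
      · have h1 : z.im = 0 := by rw [h, ofReal_im]
        have h2 : (z / q).im ≤ 0 := by
          rw [h, hrq]
          exact div_nonpos_of_nonpos_of_nonneg (by nlinarith) hN.le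
        rintro (h3 | h3 | h3) <;> linarith
      · have h1 : 0 ≤ z.im := by rw [h, im_ofReal_mul]; positivity
        have h2 : (z / q).im = 0 := by rw [h, mul_div_cancel_right₀ _ hq0, ofReal_im]
        rintro (h3 | h3 | h3) <;> linarith
    · intro h
      push Not at h
      obtain ⟨h1, h2, h3⟩ := h
      rcases h2.eq_or_lt with h4 | h4
      · have hzr : z = (z.re : ℂ) := by apply Complex.ext <;> simp [← h4]
        rcases le_or_gt 0 z.re with h5 | h5
        · exact ⟨z.re, h5, Or.inl hzr⟩
        · rw [hzr, hrq, div_nonpos_iff] at h3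
          have h6 : q.im = 0 := by
            rcases h3 with h3 | h3
            · linarith
            · nlinarith
          have h7 := hqneg h6
          refine ⟨z.re / q.re, div_nonneg_of_nonpos h5.le h7.le, Or.inr ?_⟩
          have hqr : q = (q.re : ℂ) := by apply Complex.ext <;> simp [h6]
          have hqr0 : (q.re : ℂ) ≠ 0 := by exact_mod_cast h7.ne
          rw [hqr, hzr]
          simp only [ofReal_re]
          push_cast
          field_simp
      · have h5 : (z / q).im = 0 := le_antisymm h3 (h1 h4)
        have hzs : z = ((z / q).re : ℂ) * q := by
          have : ((z / q).re : ℂ) = z / q := by apply Complex.ext <;> simp [h5]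
          rw [this]; field_simp
        refine ⟨(z / q).re, ?_, Or.inr hzs⟩
        rw [hzs, im_ofReal_mul] at h4
        by_contra! h6
        nlinarith

lemma exists_sectors {p u w : ℂ} (hu : u ≠ 0) (hw : -(w / u) ∈ slitPlane)
    {r : ℝ} (hr : 0 < r) :
    ∃ A B : Set ℂ, IsPreconnected A ∧ IsPreconnected B ∧
      Metric.ball p r \ {x | ∃ t : ℝ, 0 ≤ t ∧ (x = p + t * u ∨ x = p + t * w)} = A ∪ B := by
  rcases le_or_gt 0 (w / u).im with h | h
  · exact exists_sectors_of_im_nonneg hu hw h hr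
  · have hw0 : w ≠ 0 := by rintro rfl; simp at h
    have h1 : -(u / w) ∈ slitPlane := by
      have := slitPlane_inv hw
      rwa [inv_neg, inv_div] at this
    have h2 : 0 ≤ (u / w).im := by
      have : (u / w).im = -(w / u).im / normSq (w / u) := by rw [← inv_div, inv_im]
      rw [this]
      exact div_nonneg (by linarith) (normSq_nonneg _)
    obtain ⟨A, B, hA, hB, hAB⟩ := exists_sectors_of_im_nonneg (p := p) hw0 h1 h2 hr
    refine ⟨A, B, hA, hB, ?_⟩
    rw [← hAB]
    simp only [or_comm]

lemma eventually_mem_segment_iff_ray (a b : ℂ) (hab : a ≠ b) :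
    ∀ᶠ x in 𝓝 a, x ∈ segment ℝ a b ↔ ∃ t : ℝ, 0 ≤ t ∧ x = a + t * (b - a) := by
  have hU : 0 < ‖b - a‖ := norm_pos_iff.2 (sub_ne_zero.2 hab.symm)
  filter_upwards [Metric.ball_mem_nhds a hU] with x hx
  rw [segment_eq_image']
  constructor
  · rintro ⟨t, ht, rfl⟩
    exact ⟨t, ht.1, by simp⟩
  · rintro ⟨t, ht, rfl⟩
    refine ⟨t, ⟨ht, ?_⟩, by simp⟩
    rw [mem_ball_iff_norm, add_sub_cancel_left, norm_mul, norm_real, Real.norm_of_nonneg ht] at hx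
    by_contra! h
    nlinarith

lemma sweep_eq_of_mem_component {n : ℕ} {v : Fin n → ℂ} {x y : ℂ} (hx : x ∉ curve v)
    (hy : y ∈ connectedComponentIn (curve v)ᶜ x) : sweep v y = sweep v x :=
  sweep_eq_of_isPreconnected isPreconnected_connectedComponentIn
    (connectedComponentIn_subset _ _) hy (mem_connectedComponentIn hx)

namespace IsSimpleLoop

variable {n : ℕ} {v : Fin n → ℂ}

/-- Near each of its points a simple loop consists of two distinct rays. -/
lemma exists_rays (hv : IsSimpleLoop v) {p : ℂ} (hp : p ∈ curve v) :
    ∃ u w : ℂ, u ≠ 0 ∧ -(w / u) ∈ slitPlane ∧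
      ∀ᶠ x in 𝓝 p, x ∈ curve v ↔ ∃ t : ℝ, 0 ≤ t ∧ (x = p + t * u ∨ x = p + t * w) := by
  have hn := hv.three_le
  have hclosed : ∀ i, p ∉ edge v i → ∀ᶠ x in 𝓝 p, x ∉ edge v i := fun i hi =>
    (isClosed_edge v i).isOpen_compl.mem_nhds hi
  have hother : ∀ᶠ x in 𝓝 p, ∀ i, p ∉ edge v i → x ∉ edge v i := by
    refine eventually_all.2 fun i => ?_
    by_cases h : p ∈ edge v i
    · simp [h]
    · filter_upwards [hclosed i h] with x hx _
      exact hx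
  rcases exists_of_mem_curve hp with ⟨k, rfl⟩ | ⟨k, hk⟩
  · set j := (finRotate n).symm k with hj
    have hjk : finRotate n j = k := Equiv.apply_symm_apply _ _
    have hjne : v j ≠ v k := by
      have := hv.vertex_ne j
      rwa [hjk] at this
    have hkne := hv.vertex_ne k
    refine ⟨v (finRotate n k) - v k, v j - v k, sub_ne_zero.2 hkne.symm, ?_, ?_⟩
    · have hadj : segment ℝ (v j) (v k) ∩ segment ℝ (v k) (v (finRotate n k)) = {v k} := by
        have := hv.adjacent j
        rwa [edge, edge, hjk] at this
      have := slitPlane_inv (turn_mem_slitPlane hjne hkne hadj)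
      rwa [inv_div, ← neg_sub, neg_div] at this
    · filter_upwards [hother, eventually_mem_segment_iff_ray (v k) (v (finRotate n k)) hkne,
        eventually_mem_segment_iff_ray (v k) (v j) hjne.symm] with x h1 h2 h3
      have h4 : x ∈ curve v ↔ x ∈ segment ℝ (v k) (v (finRotate n k)) ∨
          x ∈ segment ℝ (v k) (v j) := by
        rw [segment_symm ℝ (v k) (v j)]
        constructor
        · intro hx
          obtain ⟨i, hi⟩ := mem_iUnion.1 hx
          have hmem : v k ∈ edge v i := by
            by_contra h
            exact h1 i h hi
          rcases hv.eq_or_eq_of_vertex_mem hmem with rfl | h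
          · exact Or.inl hi
          · right
            rwa [edge, h, (Equiv.eq_symm_apply _).2 h] at hi
        · rintro (h | h)
          · exact mem_iUnion.2 ⟨k, h⟩
          · refine mem_iUnion.2 ⟨j, ?_⟩
            rwa [edge, hjk]
      rw [h4, h2, h3, ← exists_or]
      simp only [and_or_left]
  · have hkne := hv.vertex_ne k
    have hp1 : p ≠ v k := by
      rintro rfl
      exact hkne (left_mem_openSegment_iff.1 hk)
    have hp2 : p ≠ v (finRotate n k) := by
      rintro rfl
      exact hkne (right_mem_openSegment_iff.1 hk)
    refine ⟨v (finRotate n k) - p, v k - p, sub_ne_zero.2 hp2.symm, ?_, ?_⟩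
    · obtain ⟨s, t, hs, ht, hst, rfl⟩ := hk
      have hU := sub_ne_zero.2 hkne.symm
      have hc : (s : ℂ) = 1 - t := by rw [eq_sub_iff_add_eq]; exact_mod_cast hst
      have e1 : v (finRotate n k) - (s • v k + t • v (finRotate n k)) =
          (s : ℂ) * (v (finRotate n k) - v k) := by
        simp only [real_smul, hc]; ring
      have e2 : v k - (s • v k + t • v (finRotate n k)) =
          -((t : ℂ) * (v (finRotate n k) - v k)) := by
        simp only [real_smul, hc]; ring
      rw [e1, e2, neg_div, neg_neg, mul_div_mul_right _ _ hU, ← ofReal_div,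
        ofReal_mem_slitPlane]
      positivity
    · filter_upwards [hother, eventually_mem_segment_iff_ray p (v (finRotate n k)) hp2,
        eventually_mem_segment_iff_ray p (v k) hp1] with x h1 h2 h3
      have h4 : x ∈ curve v ↔ x ∈ segment ℝ p (v (finRotate n k)) ∨
          x ∈ segment ℝ p (v k) := by
        have hpe : p ∈ segment ℝ (v k) (v (finRotate n k)) := openSegment_subset_segment ℝ _ _ hk
        constructor
        · intro hx
          obtain ⟨i, hi⟩ := mem_iUnion.1 hx
          have hmem : p ∈ edge v i := by
            by_contra h
            exact h1 i h hi
          obtain rfl := hv.eq_of_openSegment_mem hk hmem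
          obtain ⟨s, t, hs, ht, hst, rfl⟩ := hk
          rw [edge, segment_eq_image] at hi
          obtain ⟨ρ, hρ, rfl⟩ := hi
          have hsc : (s : ℂ) ≠ 0 := by exact_mod_cast hs.ne'
          have htc : (t : ℂ) ≠ 0 := by exact_mod_cast ht.ne'
          have hc : (s : ℂ) = 1 - t := by rw [eq_sub_iff_add_eq]; exact_mod_cast hst
          rcases le_total t ρ with h | h
          · left
            rw [segment_eq_image]
            refine ⟨(ρ - t) / s, ⟨by apply div_nonneg <;> linarith,
              (div_le_one hs).2 (by linarith [hρ.2])⟩, ?_⟩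
            simp only [real_smul]
            push_cast
            field_simp
            rw [hc]; ring
          · right
            rw [segment_eq_image]
            refine ⟨(t - ρ) / t, ⟨by apply div_nonneg <;> linarith,
              (div_le_one ht).2 (by linarith [hρ.1])⟩, ?_⟩
            simp only [real_smul]
            push_cast
            field_simp
            rw [hc]; ring
        · rintro (h | h)
          · exact mem_iUnion.2 ⟨k, (convex_segment _ _).segment_subset hpe
              (right_mem_segment ℝ _ _) h⟩
          · exact mem_iUnion.2 ⟨k, (convex_segment _ _).segment_subset hpe
              (left_mem_segment ℝ _ _) h⟩
      rw [h4, h2, h3, ← exists_or]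
      simp only [and_or_left]

/-- Near a point of the curve, the points off the curve with swept angle `0` form a single
sector. -/
lemma exists_ball_isPreconnected (hv : IsSimpleLoop v) {p : ℂ} (hp : p ∈ curve v) :
    ∃ r > 0, IsPreconnected ({x | x ∉ curve v ∧ sweep v x = 0} ∩ Metric.ball p r) := by
  obtain ⟨u, w, hu, hw, hev⟩ := hv.exists_rays hp
  obtain ⟨r, hr, hball⟩ := Metric.eventually_nhds_iff_ball.1 hev
  obtain ⟨A, B, hA, hB, hAB⟩ := exists_sectors (p := p) hu hw hr
  refine ⟨r, hr, ?_⟩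
  have hAB' : Metric.ball p r \ curve v = A ∪ B := by
    rw [← hAB]
    ext x
    exact and_congr_right fun hx => not_congr (hball x hx)
  obtain ⟨hz, hz'⟩ := hv.mem_closure_sweep hp
  obtain ⟨x₀, hx₀b, hx₀c, hx₀⟩ := mem_closure_iff.1 hz _ Metric.isOpen_ball (Metric.mem_ball_self hr)
  obtain ⟨x₁, hx₁b, hx₁c, hx₁⟩ := mem_closure_iff.1 hz' _ Metric.isOpen_ball (Metric.mem_ball_self hr)
  have hne : 2 * halfTurning v ≠ 0 := by
    have := hv.abs_halfTurning
    intro h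
    have h0 : halfTurning v = 0 := by linarith
    rw [h0, abs_zero] at this
    exact Real.pi_ne_zero this.symm
  have key : ∀ A B : Set ℂ, IsPreconnected A → IsPreconnected B →
      Metric.ball p r \ curve v = A ∪ B → x₀ ∈ A →
      IsPreconnected ({x | x ∉ curve v ∧ sweep v x = 0} ∩ Metric.ball p r) := by
    intro A B hA hB hAB hx₀A
    have hAsub : A ⊆ Metric.ball p r \ curve v := hAB ▸ subset_union_left
    have hBsub : B ⊆ Metric.ball p r \ curve v := hAB ▸ subset_union_right
    have hA0 : ∀ x ∈ A, sweep v x = 0 := fun x hx =>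
      (sweep_eq_of_isPreconnected hA (fun y hy => (hAsub hy).2) hx hx₀A).trans hx₀
    have hx₁B : x₁ ∈ B := by
      have : x₁ ∈ A ∪ B := hAB ▸ ⟨hx₁b, hx₁c⟩
      refine this.resolve_left fun h => hne ?_
      rw [← hx₁, hA0 x₁ h]
    have hB1 : ∀ x ∈ B, sweep v x ≠ 0 := fun x hx h => hne <| by
      rw [← hx₁, ← h]
      exact sweep_eq_of_isPreconnected hB (fun y hy => (hBsub hy).2) hx₁B hx
    convert hA using 1
    ext x
    constructor
    · rintro ⟨⟨h1, h2⟩, h3⟩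
      have : x ∈ A ∪ B := hAB ▸ ⟨h3, h1⟩
      exact this.resolve_right fun h => hB1 x h h2
    · intro h
      exact ⟨⟨(hAsub h).2, hA0 x h⟩, (hAsub h).1⟩
  have hx₀AB : x₀ ∈ A ∪ B := hAB' ▸ ⟨hx₀b, hx₀c⟩
  rcases hx₀AB with h | h
  · exact key A B hA hB hAB' h
  · exact key B A hB hA (by rw [hAB', union_comm]) h

lemma isPreconnected_curve (hv : IsSimpleLoop v) : IsPreconnected (curve v) := by
  have : NeZero n := ⟨by have := hv.three_le; omega⟩
  have h : curve v = ⋃ k : ℕ, edge v (Fin.ofNat n k) := by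
    refine Subset.antisymm (iUnion_subset fun i => ?_) (iUnion_subset fun k => ?_)
    · refine subset_iUnion_of_subset (i : ℕ) ?_
      rw [Fin.ofNat_val_eq_self]
    · exact subset_iUnion (edge v) _
  rw [h]
  refine IsPreconnected.iUnion_of_chain (fun k => (convex_segment _ _).isPreconnected) fun k => ?_
  refine ⟨v (Fin.ofNat n (k + 1)), ?_, left_mem_segment ℝ _ _⟩
  rw [edge, finRotate_ofNat]
  exact right_mem_segment ℝ _ _

lemma curve_nonempty (hv : IsSimpleLoop v) : (curve v).Nonempty :=
  ⟨v ⟨0, by have := hv.three_le; omega⟩, mem_iUnion.2 ⟨_, left_mem_segment ℝ _ _⟩⟩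

/-- Every component of the complement of the curve touches the curve. -/
lemma exists_mem_closure_component (hv : IsSimpleLoop v) {x : ℂ} (hx : x ∉ curve v) :
    ∃ p ∈ curve v, p ∈ closure (connectedComponentIn (curve v)ᶜ x) := by
  by_contra! h
  have hopen : ∀ y, IsOpen (connectedComponentIn (curve v)ᶜ y) := fun y =>
    (isOpen_compl_curve v).connectedComponentIn
  have hclosed : IsClosed (connectedComponentIn (curve v)ᶜ x) := by
    refine isClosed_of_closure_subset fun y hy => ?_
    have hyc : y ∈ (curve v)ᶜ := fun h' => h y h' hy
    have hyy := mem_connectedComponentIn hyc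
    obtain ⟨z, hz1, hz2⟩ := mem_closure_iff.1 hy _ (hopen y) hyy
    rwa [connectedComponentIn_eq hz2, ← connectedComponentIn_eq hz1]
  have huniv : connectedComponentIn (curve v)ᶜ x = univ :=
    IsClopen.eq_univ ⟨hclosed, hopen x⟩ ⟨x, mem_connectedComponentIn hx⟩
  obtain ⟨p, hp⟩ := hv.curve_nonempty
  have : p ∈ connectedComponentIn (curve v)ᶜ x := huniv ▸ mem_univ p
  exact connectedComponentIn_subset _ _ this hp

lemma sweep_eq_or (hv : IsSimpleLoop v) {x : ℂ} (hx : x ∉ curve v) :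
    sweep v x = 0 ∨ sweep v x = 2 * halfTurning v := by
  obtain ⟨p, hp, hpx⟩ := hv.exists_mem_closure_component hx
  obtain ⟨y, hy, hyx⟩ := mem_closure_iff_nhds.1 hpx _ (hv.eventually_abs_sweep_sub hp)
  have hyc := connectedComponentIn_subset _ _ hyx
  have h := hy hyc
  rw [sweep_eq_of_mem_component hx hyx, ← hv.abs_halfTurning, abs_eq_abs] at h
  rcases h with h | h
  · right; linarith
  · left; linarith

/-- The closure of a component with swept angle `0` contains the whole curve: the part of the curve
it touches is closed, and open because there is only one sector with swept angle `0` at each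
point. -/
lemma curve_subset_closure_component (hv : IsSimpleLoop v) {x : ℂ} (hx : x ∉ curve v)
    (hx0 : sweep v x = 0) : curve v ⊆ closure (connectedComponentIn (curve v)ᶜ x) := by
  set C := connectedComponentIn (curve v)ᶜ x with hC
  set Z := {x | x ∉ curve v ∧ sweep v x = 0} with hZ
  have hCZ : C ⊆ Z := fun y hy =>
    ⟨connectedComponentIn_subset _ _ hy, (sweep_eq_of_mem_component hx hy).trans hx0⟩
  have hlocal : ∀ p ∈ curve v, p ∈ closure C → ∃ r > 0, Z ∩ Metric.ball p r ⊆ C := by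
    intro p hp hpC
    obtain ⟨r, hr, hpre⟩ := hv.exists_ball_isPreconnected hp
    obtain ⟨y, hyb, hyC⟩ := mem_closure_iff.1 hpC _ Metric.isOpen_ball (Metric.mem_ball_self hr)
    refine ⟨r, hr, ?_⟩
    have := hpre.subset_connectedComponentIn (F := (curve v)ᶜ) ⟨hCZ hyC, hyb⟩ fun z hz => hz.1.1
    rwa [← connectedComponentIn_eq hyC] at this
  -- the open set of points near which `Z` is contained in `C`
  set O := {p : ℂ | ∀ᶠ y in 𝓝 p, y ∈ Z → y ∈ C} with hO
  have hOopen : IsOpen O := isOpen_setOfPred_eventually_nhds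
  have hOiff : ∀ p ∈ curve v, p ∈ O ↔ p ∈ closure C := by
    intro p hp
    constructor
    · intro hpO
      refine mem_closure_iff_nhds.2 fun t ht => ?_
      obtain ⟨y, hy, hyZ⟩ := mem_closure_iff_nhds.1 (hv.mem_closure_sweep hp).1 _
        (Filter.inter_mem ht hpO)
      exact ⟨y, hy.1, hy.2 hyZ⟩
    · intro hpC
      obtain ⟨r, hr, hsub⟩ := hlocal p hp hpC
      filter_upwards [Metric.ball_mem_nhds p hr] with y hy hyZ
      exact hsub ⟨hyZ, hy⟩
  obtain ⟨p₀, hp₀, hp₀C⟩ := hv.exists_mem_closure_component hx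
  by_contra hnot
  rw [not_subset] at hnot
  obtain ⟨p₁, hp₁, hp₁C⟩ := hnot
  obtain ⟨p, hp, hpO, hpC⟩ := hv.isPreconnected_curve O (closure C)ᶜ hOopen
    isClosed_closure.isOpen_compl (fun p hp => by
      by_cases h : p ∈ closure C
      · exact Or.inl ((hOiff p hp).2 h)
      · exact Or.inr h) ⟨p₀, hp₀, (hOiff p₀ hp₀).2 hp₀C⟩ ⟨p₁, hp₁, hp₁C⟩
  exact hpC ((hOiff p hp).1 hpO)

lemma mem_component_of_sweep_eq_zero (hv : IsSimpleLoop v) {x y : ℂ} (hx : x ∉ curve v)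
    (hx0 : sweep v x = 0) (hy : y ∉ curve v) (hy0 : sweep v y = 0) :
    y ∈ connectedComponentIn (curve v)ᶜ x := by
  obtain ⟨p, hp⟩ := hv.curve_nonempty
  have hpx := hv.curve_subset_closure_component hx hx0 hp
  have hpy := hv.curve_subset_closure_component hy hy0 hp
  obtain ⟨r, hr, hpre⟩ := hv.exists_ball_isPreconnected hp
  obtain ⟨x', hx'b, hx'⟩ := mem_closure_iff.1 hpx _ Metric.isOpen_ball (Metric.mem_ball_self hr)
  obtain ⟨y', hy'b, hy'⟩ := mem_closure_iff.1 hpy _ Metric.isOpen_ball (Metric.mem_ball_self hr)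
  have hsub := hpre.subset_connectedComponentIn (F := (curve v)ᶜ) (x := x')
    ⟨⟨connectedComponentIn_subset _ _ hx', (sweep_eq_of_mem_component hx hx').trans hx0⟩, hx'b⟩
    fun z hz => hz.1.1
  have hy'x := hsub ⟨⟨connectedComponentIn_subset _ _ hy',
    (sweep_eq_of_mem_component hy hy').trans hy0⟩, hy'b⟩
  rw [← connectedComponentIn_eq hx'] at hy'x
  rw [connectedComponentIn_eq hy'x, ← connectedComponentIn_eq hy']
  exact mem_connectedComponentIn hy

/-- The bounded components of the complement of a simple loop are where the swept angle does
not vanish. -/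
lemma isBounded_component_iff (hv : IsSimpleLoop v) {x : ℂ} (hx : x ∉ curve v) :
    Bornology.IsBounded (connectedComponentIn (curve v)ᶜ x) ↔ sweep v x ≠ 0 := by
  obtain ⟨R, hR⟩ := exists_sweep_eq_zero v
  constructor
  · intro hb hx0
    obtain ⟨R₁, hR₁⟩ := (hb.union (isCompact_curve v).isBounded).exists_norm_le
    -- a real point far enough away to have swept angle `0` and to lie outside the component
    set s : ℝ := |R| + |R₁| + 1 with hs
    have hs0 : 0 ≤ s := by positivity
    have hnorm : ‖(s : ℂ)‖ = s := by rw [norm_real, Real.norm_of_nonneg hs0]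
    have hsR : R < ‖(s : ℂ)‖ := by
      rw [hnorm]
      linarith [le_abs_self R, abs_nonneg R₁]
    have hsR₁ : ¬ ‖(s : ℂ)‖ ≤ R₁ := by
      rw [hnorm]
      linarith [le_abs_self R₁, abs_nonneg R]
    have hsc : (s : ℂ) ∉ curve v := fun h => hsR₁ (hR₁ _ (Or.inr h))
    exact hsR₁ (hR₁ _ (Or.inl (hv.mem_component_of_sweep_eq_zero hx hx0 hsc (hR _ hsR))))
  · intro hx0
    refine isBounded_iff_forall_norm_le.2 ⟨R, fun y hy => ?_⟩
    by_contra! h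
    exact hx0 ((sweep_eq_of_mem_component hx hy).symm.trans (hR y h))

end IsSimpleLoop

/-! ### Comparing lattice sums with integrals -/

/-- The embedding of the integer lattice in the complex plane. -/
noncomputable def latticePt : ℤ × ℤ →+ ℂ where
  toFun m := ⟨m.1, m.2⟩
  map_zero' := by apply Complex.ext <;> simp
  map_add' a b := by apply Complex.ext <;> simp

@[simp] lemma latticePt_re (m : ℤ × ℤ) : (latticePt m).re = m.1 := rfl

@[simp] lemma latticePt_im (m : ℤ × ℤ) : (latticePt m).im = m.2 := rfl

lemma latticePt_injective : Function.Injective latticePt := by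
  intro a b h
  have h1 := congrArg re h
  have h2 := congrArg im h
  simp only [latticePt_re, latticePt_im, Int.cast_inj] at h1 h2
  exact Prod.ext h1 h2

lemma finite_latticePt_preimage {S : Set ℂ} (hS : Bornology.IsBounded S) :
    (latticePt ⁻¹' S).Finite := by
  obtain ⟨R, hR⟩ := hS.exists_norm_le
  refine (Set.finite_Icc (-⌈R⌉, -⌈R⌉) (⌈R⌉, ⌈R⌉)).subset fun m hm => ?_
  have h := hR _ hm
  have h1 := abs_le.1 ((abs_re_le_norm _).trans (h.trans (Int.le_ceil R)))
  have h2 := abs_le.1 ((abs_im_le_norm _).trans (h.trans (Int.le_ceil R)))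
  simp only [latticePt_re, latticePt_im] at h1 h2
  refine ⟨⟨?_, ?_⟩, ⟨?_, ?_⟩⟩
  · exact_mod_cast h1.1
  · exact_mod_cast h2.1
  · exact_mod_cast h1.2
  · exact_mod_cast h2.2

/-- Bounded measurable functions with bounded support. -/
structure IsTame (f : ℂ → ℝ) : Prop where
  measurable : Measurable f
  bounded : ∃ B : ℝ, ∀ x, |f x| ≤ B
  eq_zero : ∃ R : ℝ, ∀ x, R < ‖x‖ → f x = 0

/-- The error made in replacing the integral of a function by its sum over the integer lattice. -/
noncomputable def discrepancy (f : ℂ → ℝ) : ℝ := ∑' m, f (latticePt m) - ∫ x, f x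

namespace IsTame

variable {f : ℂ → ℝ}

lemma integrable (hf : IsTame f) : Integrable f := by
  obtain ⟨B, hB⟩ := hf.bounded
  obtain ⟨R, hR⟩ := hf.eq_zero
  have hsub : Function.support f ⊆ Metric.closedBall 0 R := by
    intro x hx
    rw [mem_closedBall_zero_iff]
    by_contra! h
    exact hx (hR x h)
  rw [← integrableOn_iff_integrable_of_support_subset hsub]
  exact Measure.integrableOn_of_bounded (M := B) measure_closedBall_lt_top.ne
    hf.measurable.aestronglyMeasurable (ae_of_all _ fun x => hB x)

lemma summable (hf : IsTame f) : Summable fun m => f (latticePt m) := by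
  obtain ⟨R, hR⟩ := hf.eq_zero
  refine summable_of_hasFiniteSupport
    ((finite_latticePt_preimage (Metric.isBounded_closedBall (x := 0) (r := R))).subset ?_)
  intro m hm
  rw [mem_preimage, mem_closedBall_zero_iff]
  by_contra! h
  exact hm (hR _ h)

end IsTame

lemma isTame_sweep {n : ℕ} (v : Fin n → ℂ) : IsTame (sweep v) :=
  ⟨measurable_sweep v, ⟨_, abs_sweep_le v⟩, exists_sweep_eq_zero v⟩

lemma discrepancy_sum {ι : Type*} (s : Finset ι) (f : ι → ℂ → ℝ) (hf : ∀ i ∈ s, IsTame (f i)) :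
    discrepancy (fun x => ∑ i ∈ s, f i x) = ∑ i ∈ s, discrepancy (f i) := by
  unfold discrepancy
  rw [Summable.tsum_finsetSum fun i hi => (hf i hi).summable,
    integral_finsetSum _ fun i hi => (hf i hi).integrable, Finset.sum_sub_distrib]

lemma discrepancy_translate (f : ℂ → ℝ) (t : ℤ × ℤ) :
    discrepancy (fun x => f (x - latticePt t)) = discrepancy f := by
  unfold discrepancy
  rw [integral_sub_right_eq_self (fun x => f x)]
  congr 1
  rw [← (Equiv.subRight t).tsum_eq fun m => f (latticePt m)]
  simp

lemma discrepancy_neg (f : ℂ → ℝ) : discrepancy (fun x => f (-x)) = discrepancy f := by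
  unfold discrepancy
  rw [integral_neg_eq_self (fun x => f x)]
  congr 1
  rw [← (Equiv.neg (ℤ × ℤ)).tsum_eq fun m => f (latticePt m)]
  simp

lemma sweep_triangle (a b c x : ℂ) :
    sweep ![a, b, c] x = viewAngle x a b + viewAngle x b c + viewAngle x c a := by
  simp [sweep, Fin.sum_univ_three]

/-- The discrepancy of the angle swept by a triangle with a vertex at the origin. -/
noncomputable def triangleDiscrepancy (a b : ℤ × ℤ) : ℝ :=
  discrepancy (sweep ![0, latticePt a, latticePt b])

/-- A closed lattice polygon is, as far as swept angles are concerned, the sum of the triangles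
spanned by the origin and its edges. -/
lemma discrepancy_sweep {n : ℕ} (m : Fin n → ℤ × ℤ) :
    discrepancy (sweep fun i => latticePt (m i)) =
      ∑ i, triangleDiscrepancy (m i) (m (finRotate n i)) := by
  unfold triangleDiscrepancy
  rw [← discrepancy_sum _ _ fun i _ => isTame_sweep _]
  congr 1
  ext x
  simp only [sweep_triangle]
  rw [Finset.sum_add_distrib, Finset.sum_add_distrib,
    sum_finRotate (fun i => viewAngle x (latticePt (m i)) 0)]
  simp only [viewAngle_symm x 0, Finset.sum_neg_distrib]
  rw [sweep]
  ring

lemma discrepancy_triangle (a b c : ℤ × ℤ) :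
    discrepancy (sweep ![latticePt a, latticePt b, latticePt c]) =
      triangleDiscrepancy a b + triangleDiscrepancy b c + triangleDiscrepancy c a := by
  have h := discrepancy_sweep ![a, b, c]
  have e : (fun i => latticePt (![a, b, c] i)) = ![latticePt a, latticePt b, latticePt c] := by
    ext i; fin_cases i <;> rfl
  rw [e] at h
  rw [h]
  simp [Fin.sum_univ_three]

lemma triangleDiscrepancy_swap (a b : ℤ × ℤ) :
    triangleDiscrepancy b a = -triangleDiscrepancy a b := by
  have h := discrepancy_sum Finset.univ
    ![sweep ![0, latticePt a, latticePt b], sweep ![0, latticePt b, latticePt a]]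
    (fun i _ => by fin_cases i <;> exact isTame_sweep _)
  simp only [Fin.sum_univ_two, Matrix.cons_val_zero, Matrix.cons_val_one, sweep_triangle] at h
  have e : ∀ x, viewAngle x 0 (latticePt a) + viewAngle x (latticePt a) (latticePt b) +
      viewAngle x (latticePt b) 0 + (viewAngle x 0 (latticePt b) +
      viewAngle x (latticePt b) (latticePt a) + viewAngle x (latticePt a) 0) = 0 := fun x => by
    rw [viewAngle_symm x 0 (latticePt a), viewAngle_symm x 0 (latticePt b),
      viewAngle_symm x (latticePt a) (latticePt b)]
    ring
  simp only [e] at h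
  have h0 : discrepancy (fun _ => 0) = 0 := by simp [discrepancy]
  rw [h0] at h
  unfold triangleDiscrepancy
  linarith

lemma triangleDiscrepancy_translate (a b t : ℤ × ℤ) :
    triangleDiscrepancy t (a + t) + triangleDiscrepancy (a + t) (b + t)
      + triangleDiscrepancy (b + t) t = triangleDiscrepancy a b := by
  rw [← discrepancy_triangle, triangleDiscrepancy,
    ← discrepancy_translate (sweep ![0, latticePt a, latticePt b]) t]
  congr 1
  ext x
  have e := viewAngle_add (latticePt t) (x - latticePt t)
  simp only [sub_add_cancel] at e
  have e1 := e 0 (latticePt a)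
  have e2 := e (latticePt b) 0
  rw [zero_add] at e1 e2
  simp only [sweep_triangle, map_add, e, e1, e2]

lemma triangleDiscrepancy_neg (a b : ℤ × ℤ) :
    triangleDiscrepancy (-a) (-b) = triangleDiscrepancy a b := by
  rw [triangleDiscrepancy, triangleDiscrepancy, ← discrepancy_neg]
  congr 1
  ext x
  have e := viewAngle_neg x
  simp only [sweep_triangle, map_neg, ← e, neg_zero]

/-- An antisymmetric function of two vectors such that the induced function on triangles is
invariant under translations and under the point reflection is additive in the first argument:
cutting parallelograms along diagonals shows invariance under shears, and then the deviation
from additivity is both symmetric and antisymmetric. -/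
lemma add_left_of_triangle_invariant {A : Type*} [AddCommGroup A] {G : A → A → ℝ}
    (hswap : ∀ a b, G b a = -G a b)
    (htrans : ∀ a b t, G t (a + t) + G (a + t) (b + t) + G (b + t) t = G a b)
    (hneg : ∀ a b, G (-a) (-b) = G a b) (a b c : A) : G (a + b) c = G a c + G b c := by
  have h0 : ∀ a, G a 0 = 0 := by
    intro a
    have h1 := htrans 0 a 0
    have h2 := hswap 0 0
    simp only [add_zero] at h1
    linarith
  have h0' : ∀ a, G 0 a = 0 := fun a => by rw [hswap a 0, h0, neg_zero]
  have hrefl : ∀ a b, G (a + b) b = G a (a + b) := by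
    intro a b
    have h := htrans (-a) (-(a + b)) (a + b)
    rw [hneg, neg_add_cancel, neg_add_cancel_left, h0, h0'] at h
    linarith
  have hdiag : ∀ a b, G a (a + b) + G (a + b) b = 2 * G a b := by
    intro a b
    have h := htrans (-a) (-b) (a + b)
    have e : -b + (a + b) = a := by abel
    rw [hneg, neg_add_cancel_left, e] at h
    have := hswap a b
    linarith
  have hsh1 : ∀ a b, G a (a + b) = G a b := fun a b => by
    have := hrefl a b; have := hdiag a b; linarith
  have hsh2 : ∀ a b, G (a + b) b = G a b := fun a b => by
    have := hrefl a b; have := hdiag a b; linarith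
  have hE : ∀ a c t, G (a + t) c + G (a + c) t = G a c + G a t := by
    intro a c t
    have h := htrans a (a + c) t
    have e : a + c + t = a + t + c := by abel
    have e1 : G t (a + t) = G t a := by rw [add_comm, hsh1]
    rw [e, hsh1, hsh1, ← e, hsh2, e1, hswap a t] at h
    linarith
  have h1 := hE a c b
  have h2 := hE c b a
  have h3 := hE b a c
  rw [add_comm c a, add_comm c b] at h2
  rw [add_comm b a] at h3
  linarith [hswap a c, hswap b c, hswap a b]

/-! ### The standard triangle -/

/-- A point separated from the standard triangle by the line through one of its edges. -/
lemma sweep_stdTriangle_of_neg {x : ℂ} (h : x.re < 0 ∨ x.im < 0 ∨ 1 < x.re + x.im) :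
    sweep ![0, 1, I] x = 0 := by
  rcases h with h | h | h
  · refine sweep_of_halfPlane (h := 1) fun i => ?_
    fin_cases i <;> simp <;> linarith
  · refine sweep_of_halfPlane (h := I) fun i => ?_
    fin_cases i <;> simp <;> linarith
  · refine sweep_of_halfPlane (h := -(1 + I)) fun i => ?_
    have e : ∀ z : ℂ, (z / (-(1 + I))).re = -(z.re + z.im) / 2 := by
      intro z
      rw [div_re]
      simp [normSq_apply]
      ring
    rw [e]
    fin_cases i <;> simp <;> linarith

lemma im_div_pos {z w : ℂ} (h : 0 < z.im * w.re - z.re * w.im) : 0 < (z / w).im := by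
  have hw : w ≠ 0 := by rintro rfl; simp at h
  rw [div_im, ← sub_div]
  exact div_pos h (normSq_pos.2 hw)

/-- The open triangle with vertices `0`, `1` and `I`. -/
def stdTriangle : Set ℂ := {x | 0 < x.re ∧ 0 < x.im ∧ x.re + x.im < 1}

lemma sweep_stdTriangle_of_mem {x : ℂ} (hx : x ∈ stdTriangle) :
    sweep ![0, 1, I] x = 2 * π := by
  obtain ⟨h1, h2, h3⟩ := hx
  have hview : ∀ a b : ℂ, 0 < ((b - x) / (a - x)).im →
      x ∉ segment ℝ a b ∧ 0 < viewAngle x a b := by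
    intro a b h
    have hm : (b - x) / (a - x) ∈ slitPlane := by
      rw [mem_slitPlane_iff]; exact Or.inr h.ne'
    refine ⟨notMem_segment_iff.2 hm, ?_⟩
    rw [viewAngle, slitArg_of_mem hm]
    refine lt_of_le_of_ne (arg_nonneg_iff.2 h.le) fun h0 => ?_
    exact h.ne' (arg_eq_zero_iff.1 h0.symm).2
  obtain ⟨n1, p1⟩ := hview 0 1 (im_div_pos (by simp; nlinarith))
  obtain ⟨n2, p2⟩ := hview 1 I (im_div_pos (by simp; nlinarith))
  obtain ⟨n3, p3⟩ := hview I 0 (im_div_pos (by simp; nlinarith))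
  have q1 := (abs_lt.1 (abs_viewAngle_lt x 0 1)).2
  have q2 := (abs_lt.1 (abs_viewAngle_lt x 1 I)).2
  have q3 := (abs_lt.1 (abs_viewAngle_lt x I 0)).2
  rw [sweep_triangle]
  refine sub_eq_zero.1 (eq_zero_of_coe_angle_eq_zero ?_ ?_)
  · rw [Real.Angle.coe_sub, Real.Angle.coe_add, Real.Angle.coe_add, viewAngle_coe n1,
      viewAngle_coe n2, viewAngle_coe n3, Real.Angle.coe_two_pi]
    abel
  · rw [abs_lt]
    constructor <;> linarith

lemma tsum_sweep_stdTriangle : ∑' m, sweep ![0, 1, I] (latticePt m) = π := by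
  rw [tsum_eq_sum (s := {(0, 0), (1, 0), (0, 1)})]
  · rw [Finset.sum_insert (by decide), Finset.sum_insert (by decide), Finset.sum_singleton]
    have e0 : latticePt (0, 0) = 0 := latticePt.map_zero
    have e1 : latticePt (1, 0) = 1 := by apply Complex.ext <;> simp
    have e2 : latticePt (0, 1) = I := by apply Complex.ext <;> simp
    rw [e0, e1, e2, sweep_triangle, sweep_triangle, sweep_triangle]
    simp only [viewAngle_left, viewAngle_right, add_zero, zero_add]
    have hm : 1 + I ∈ slitPlane := by simp [mem_slitPlane_iff]
    have a0 : viewAngle 0 1 I = π / 2 := by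
      rw [viewAngle, sub_zero, sub_zero, div_one, slitArg_of_mem (by simp [mem_slitPlane_iff]),
        arg_I]
    have a1 : viewAngle 1 I 0 = arg (1 + I) := by
      have : (0 - 1) / (I - 1) = ((1 / 2 : ℝ) : ℂ) * (1 + I) := by
        have h : I - 1 ≠ 0 := fun h => by simpa using congrArg im h
        rw [div_eq_iff h]
        push_cast
        linear_combination (-1 / 2 : ℂ) * I_sq
      rw [viewAngle, this, slitArg_real_mul (by norm_num), slitArg_of_mem hm]
    have a2 : viewAngle I 0 1 = arg (1 + I) := by
      have : (1 - I) / (0 - I) = 1 + I := by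
        rw [div_eq_iff (by simp)]
        linear_combination I_sq
      rw [viewAngle, this, slitArg_of_mem hm]
    -- twice the argument of `1 + I` is that of `(1 + I) ^ 2 = 2 * I`
    have hne : (1 : ℂ) + I ≠ 0 := slitPlane_ne_zero hm
    have h2 : arg (1 + I) + arg (1 + I) = π / 2 := by
      refine sub_eq_zero.1 (eq_zero_of_coe_angle_eq_zero ?_ ?_)
      · have e : (1 + I) * (1 + I) = ((2 : ℝ) : ℂ) * I := by
          push_cast
          linear_combination I_sq
        rw [Real.Angle.coe_sub, Real.Angle.coe_add, ← arg_mul_coe_angle hne hne, e,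
          arg_real_mul _ two_pos, arg_I, sub_self]
      · have := abs_lt.1 (abs_arg_lt_pi_div_two_iff.2 (Or.inl (by simp : 0 < (1 + I).re)))
        rw [abs_lt]
        constructor <;> linarith [this.1, this.2, Real.pi_pos]
    rw [a0, a1, a2]
    linarith
  · intro m hm
    simp only [Finset.mem_insert, Finset.mem_singleton, not_or] at hm
    obtain ⟨a, b⟩ := m
    refine sweep_stdTriangle_of_neg ?_
    simp only [latticePt_re, latticePt_im]
    have : a < 0 ∨ b < 0 ∨ 1 < a + b := by
      simp only [Prod.mk.injEq] at hm
      omega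
    exact_mod_cast this

lemma volume_stdTriangle : volume stdTriangle = ENNReal.ofReal (1 / 2) := by
  have h : stdTriangle = measurableEquivRealProd ⁻¹'
      regionBetween (fun _ => 0) (fun t => 1 - t) (Ioo 0 1) := by
    ext x
    simp only [stdTriangle, regionBetween, mem_ofPred_eq, mem_preimage, mem_Ioo,
      measurableEquivRealProd_apply]
    constructor
    · rintro ⟨h1, h2, h3⟩
      exact ⟨⟨h1, by linarith⟩, h2, by linarith⟩
    · rintro ⟨⟨h1, _⟩, h2, h3⟩
      exact ⟨h1, h2, by linarith⟩
  rw [h, volume_preserving_equiv_real_prod.measure_preimage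
    (measurableSet_regionBetween (by fun_prop) (by fun_prop) measurableSet_Ioo).nullMeasurableSet,
    Measure.volume_eq_prod,
    volume_regionBetween_eq_integral (by simp) ?_ measurableSet_Ioo fun t ht => by
      simpa using ht.2.le]
  · congr 1
    rw [← integral_Ioc_eq_integral_Ioo, ← intervalIntegral.integral_of_le zero_le_one]
    simp only [Pi.sub_apply, sub_zero]
    rw [intervalIntegral.integral_sub (continuous_const.intervalIntegrable _ _)
      (continuous_id'.intervalIntegrable _ _), integral_id]
    norm_num
  · exact (Continuous.integrableOn_Icc (by fun_prop)).mono_set Ioo_subset_Icc_self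

/-- A polygonal curve is a null set. -/
lemma volume_curve {n : ℕ} (v : Fin n → ℂ) : volume (curve v) = 0 := by
  refine measure_iUnion_null fun i => ?_
  refine measure_mono_null (t := (affineSpan ℝ {v i, v (finRotate n i)} : Set ℂ)) ?_ ?_
  · rw [edge, ← convexHull_pair]
    exact convexHull_subset_affineSpan _
  · refine Measure.addHaar_affineSubspace _ _ fun h => ?_
    have h1 := (collinear_pair ℝ (v i) (v (finRotate n i))).finrank_le_one
    rw [← direction_affineSpan, h, AffineSubspace.direction_top, finrank_top,
      Complex.finrank_real_complex] at h1
    omega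

lemma integral_sweep_stdTriangle : ∫ x, sweep ![0, 1, I] x = π := by
  have hmeas : MeasurableSet stdTriangle := by
    refine (measurableSet_lt measurable_const measurable_re).inter
      ((measurableSet_lt measurable_const measurable_im).inter
      (measurableSet_lt (measurable_re.add measurable_im) measurable_const))
  have hae : sweep ![0, 1, I] =ᵐ[volume] stdTriangle.indicator fun _ => 2 * π := by
    filter_upwards [measure_eq_zero_iff_ae_notMem.1 (volume_curve ![0, 1, I])] with x hx
    by_cases hT : x ∈ stdTriangle
    · rw [indicator_of_mem hT, sweep_stdTriangle_of_mem hT]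
    rw [indicator_of_notMem hT]
    refine sweep_stdTriangle_of_neg ?_
    by_contra! h
    obtain ⟨h1, h2, h3⟩ := h
    have h0 : x ∉ segment ℝ 0 1 := notMem_edge hx 0
    have h4 : x ∉ segment ℝ 1 I := notMem_edge hx 1
    have h5 : x ∉ segment ℝ I 0 := notMem_edge hx 2
    have e1 : x.im ≠ 0 := fun e => h0 ⟨1 - x.re, x.re, by linarith, h1, by ring, by
      apply Complex.ext <;> simp [e]⟩
    have e2 : x.re ≠ 0 := fun e => h5 ⟨x.im, 1 - x.im, h2, by linarith, by ring, by
      apply Complex.ext <;> simp [e]⟩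
    have e3 : x.re + x.im ≠ 1 := fun e => h4 ⟨x.re, x.im, h1, h2, e, by
      apply Complex.ext <;> simp⟩
    exact hT ⟨lt_of_le_of_ne h1 e2.symm, lt_of_le_of_ne h2 e1.symm, lt_of_le_of_ne h3 e3⟩
  rw [integral_congr_ae hae, integral_indicator_const _ hmeas, Measure.real, volume_stdTriangle,
    ENNReal.toReal_ofReal (by norm_num), smul_eq_mul]
  ring

lemma triangleDiscrepancy_std : triangleDiscrepancy (1, 0) (0, 1) = 0 := by
  have e1 : latticePt (1, 0) = 1 := by apply Complex.ext <;> simp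
  have e2 : latticePt (0, 1) = I := by apply Complex.ext <;> simp
  rw [triangleDiscrepancy, discrepancy, e1, e2, tsum_sweep_stdTriangle,
    integral_sweep_stdTriangle, sub_self]

/-- The discrepancy of lattice triangles is an alternating bilinear form on `ℤ × ℤ`, and it
vanishes on the standard basis. -/
lemma triangleDiscrepancy_eq_zero (a b : ℤ × ℤ) : triangleDiscrepancy a b = 0 := by
  have hl : ∀ a b c, triangleDiscrepancy (a + b) c =
      triangleDiscrepancy a c + triangleDiscrepancy b c :=
    add_left_of_triangle_invariant triangleDiscrepancy_swap triangleDiscrepancy_translate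
      triangleDiscrepancy_neg
  have hself : ∀ a, triangleDiscrepancy a a = 0 := fun a => by
    have := triangleDiscrepancy_swap a a
    linarith
  have hspan : ∀ c, triangleDiscrepancy (1, 0) c = 0 → triangleDiscrepancy (0, 1) c = 0 →
      ∀ a, triangleDiscrepancy a c = 0 := by
    intro c h1 h2 a
    let f : ℤ × ℤ →+ ℝ := AddMonoidHom.mk' (fun a => triangleDiscrepancy a c) fun a b => hl a b c
    have ha : a = a.1 • ((1, 0) : ℤ × ℤ) + a.2 • ((0, 1) : ℤ × ℤ) := by ext <;> simp
    have hf : f a = 0 := by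
      rw [ha, map_add, map_zsmul, map_zsmul]
      change a.1 • triangleDiscrepancy (1, 0) c + a.2 • triangleDiscrepancy (0, 1) c = 0
      rw [h1, h2]
      simp
    exact hf
  refine hspan b ?_ ?_ a
  · rw [triangleDiscrepancy_swap b, hspan (1, 0) (hself _) ?_ b, neg_zero]
    rw [triangleDiscrepancy_swap, triangleDiscrepancy_std, neg_zero]
  · rw [triangleDiscrepancy_swap b, hspan (0, 1) triangleDiscrepancy_std (hself _) b, neg_zero]

/-- For a closed lattice polygon, the swept angle has the same sum over the integer lattice as
its integral over the plane. -/
theorem tsum_sweep_eq_integral {n : ℕ} (m : Fin n → ℤ × ℤ) :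
    ∑' z, sweep (fun i => latticePt (m i)) (latticePt z) =
      ∫ x, sweep (fun i => latticePt (m i)) x := by
  have h := discrepancy_sweep m
  simp only [triangleDiscrepancy_eq_zero, Finset.sum_const_zero] at h
  exact sub_eq_zero.1 h

/-! ### Pick's formula -/

/-- The points enclosed by a closed polygonal curve in the complex plane. -/
def enclosed {n : ℕ} (v : Fin n → ℂ) : Set ℂ :=
  {x | x ∉ curve v ∧ Bornology.IsBounded (connectedComponentIn (curve v)ᶜ x)}

namespace IsSimpleLoop

variable {n : ℕ} {v : Fin n → ℂ}

lemma mem_enclosed_iff (hv : IsSimpleLoop v) {x : ℂ} :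
    x ∈ enclosed v ↔ x ∉ curve v ∧ sweep v x ≠ 0 :=
  and_congr_right fun hx => hv.isBounded_component_iff hx

lemma measurableSet_enclosed (hv : IsSimpleLoop v) : MeasurableSet (enclosed v) := by
  have : enclosed v = (curve v)ᶜ ∩ (sweep v ⁻¹' {0})ᶜ := by
    ext x
    exact hv.mem_enclosed_iff
  rw [this]
  exact (isOpen_compl_curve v).measurableSet.inter
    (measurable_sweep v (measurableSet_singleton 0)).compl

lemma isBounded_enclosed (hv : IsSimpleLoop v) : Bornology.IsBounded (enclosed v) := by
  obtain ⟨R, hR⟩ := exists_sweep_eq_zero v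
  refine isBounded_iff_forall_norm_le.2 ⟨R, fun y hy => ?_⟩
  by_contra! h
  exact (hv.mem_enclosed_iff.1 hy).2 (hR y h)

lemma sweep_of_mem_enclosed (hv : IsSimpleLoop v) {x : ℂ} (hx : x ∈ enclosed v) :
    sweep v x = 2 * halfTurning v :=
  (hv.sweep_eq_or hx.1).resolve_left (hv.mem_enclosed_iff.1 hx).2

lemma integral_sweep (hv : IsSimpleLoop v) :
    ∫ x, sweep v x = 2 * halfTurning v * (volume (enclosed v)).toReal := by
  have hae : sweep v =ᵐ[volume] (enclosed v).indicator fun _ => 2 * halfTurning v := by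
    filter_upwards [measure_eq_zero_iff_ae_notMem.1 (volume_curve v)] with x hx
    by_cases hxe : x ∈ enclosed v
    · rw [indicator_of_mem hxe, hv.sweep_of_mem_enclosed hxe]
    · rw [indicator_of_notMem hxe]
      by_contra h
      exact hxe (hv.mem_enclosed_iff.2 ⟨hx, h⟩)
  rw [integral_congr_ae hae, integral_indicator_const _ hv.measurableSet_enclosed, Measure.real,
    smul_eq_mul, mul_comm]

lemma sweep_of_mem_curve (hv : IsSimpleLoop v) {x : ℂ} (hx : x ∈ curve v) :
    sweep v x = halfTurning v - ∑ k, if x = v k then turn v k else 0 := by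
  by_cases h : ∃ k, x = v k
  · obtain ⟨k, rfl⟩ := h
    simp [hv.sweep_vertex, hv.injective.eq_iff]
  · rw [Finset.sum_eq_zero fun k _ => if_neg fun hk => h ⟨k, hk⟩, sub_zero]
    obtain ⟨k, hk⟩ := (exists_of_mem_curve hx).resolve_left h
    exact hv.sweep_openSegment hk

/-- Enclosed lattice points count twice and lattice points on the curve once, up to a correction at
the vertices which adds up to the total turning. -/
lemma tsum_sweep (hv : IsSimpleLoop v) (hm : ∀ i, v i ∈ range latticePt) :
    ∑' z, sweep v (latticePt z) = 2 * halfTurning v *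
      ((latticePt ⁻¹' enclosed v).ncard + ((latticePt ⁻¹' curve v).ncard : ℝ) / 2 - 1) := by
  classical
  choose m hm using hm
  have hI := finite_latticePt_preimage hv.isBounded_enclosed
  have hU := finite_latticePt_preimage (isCompact_curve v).isBounded
  have hdisj : Disjoint hI.toFinset hU.toFinset := by
    rw [Set.Finite.disjoint_toFinset]
    exact Set.disjoint_left.2 fun z hz hz' => hz.1 hz'
  rw [tsum_eq_sum (s := hI.toFinset ∪ hU.toFinset), Finset.sum_union hdisj]
  · have h1 : ∑ z ∈ hI.toFinset, sweep v (latticePt z) =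
        (latticePt ⁻¹' enclosed v).ncard * (2 * halfTurning v) := by
      rw [Finset.sum_congr rfl fun z hz => hv.sweep_of_mem_enclosed (hI.mem_toFinset.1 hz),
        Finset.sum_const, nsmul_eq_mul, Set.ncard_eq_toFinset_card _ hI]
    have h2 : ∑ z ∈ hU.toFinset, sweep v (latticePt z) =
        (latticePt ⁻¹' curve v).ncard * halfTurning v - ∑ k, turn v k := by
      rw [Finset.sum_congr rfl fun z hz => hv.sweep_of_mem_curve (hU.mem_toFinset.1 hz),
        Finset.sum_sub_distrib, Finset.sum_const, nsmul_eq_mul, Set.ncard_eq_toFinset_card _ hU,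
        Finset.sum_comm]
      congr 1
      refine Finset.sum_congr rfl fun k _ => ?_
      have hk : ∀ z, latticePt z = v k ↔ z = m k := fun z => by
        rw [← hm k, latticePt_injective.eq_iff]
      have hmem : m k ∈ hU.toFinset := by
        rw [hU.mem_toFinset, mem_preimage, hm k]
        exact mem_iUnion.2 ⟨k, left_mem_segment ℝ _ _⟩
      simp only [hk]
      rw [Finset.sum_ite_eq', if_pos hmem]
    have h3 : ∑ k, turn v k = 2 * halfTurning v := by rw [halfTurning]; ring
    rw [h1, h2, h3]
    ring
  · intro z hz
    simp only [Finset.mem_union, Set.Finite.mem_toFinset, mem_preimage, not_or] at hz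
    by_contra h
    exact hz.1 (hv.mem_enclosed_iff.2 ⟨hz.2, h⟩)

theorem volume_enclosed (hv : IsSimpleLoop v) (hm : ∀ i, v i ∈ range latticePt) :
    (volume (enclosed v)).toReal =
      (latticePt ⁻¹' enclosed v).ncard + ((latticePt ⁻¹' curve v).ncard : ℝ) / 2 - 1 := by
  have h0 : 2 * halfTurning v ≠ 0 := by
    intro h
    have h1 := hv.abs_halfTurning
    have h2 : halfTurning v = 0 := by linarith
    rw [h2, abs_zero] at h1
    exact Real.pi_ne_zero h1.symm
  refine mul_left_cancel₀ h0 ?_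
  rw [← hv.tsum_sweep hm, ← hv.integral_sweep]
  choose m hm using hm
  obtain rfl : (fun i => latticePt (m i)) = v := funext hm
  exact (tsum_sweep_eq_integral m).symm

end IsSimpleLoop

/-! ### Transfer to the Euclidean plane -/

/-- The vertices of a polygon in the Euclidean plane, as complex numbers. -/
noncomputable def complexVertices {n : ℕ} (P : Polygon (EuclideanSpace ℝ (Fin 2)) n) (i : Fin n) :
    ℂ :=
  orthonormalBasisOneI.repr.symm (P i)

section Transfer

variable {n : ℕ} (P : Polygon (EuclideanSpace ℝ (Fin 2)) n)

lemma preimage_edgeSet (i : Fin n) :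
    orthonormalBasisOneI.repr ⁻¹' P.edgeSet ℝ i = edge (complexVertices P) i := by
  rw [Polygon.edgeSet, affineSegment_eq_segment, edge]
  have h := image_segment ℝ orthonormalBasisOneI.repr.symm.toLinearEquiv.toLinearMap.toAffineMap
    (P i) (P (finRotate n i))
  refine Eq.trans ?_ h
  ext x
  constructor
  · intro hx
    exact ⟨_, hx, by simp⟩
  · rintro ⟨y, hy, rfl⟩
    change orthonormalBasisOneI.repr (orthonormalBasisOneI.repr.symm y) ∈
      segment ℝ (P i) (P (finRotate n i))
    rwa [LinearIsometryEquiv.apply_symm_apply]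

lemma preimage_boundary :
    orthonormalBasisOneI.repr ⁻¹' P.boundary ℝ = curve (complexVertices P) := by
  rw [Polygon.boundary, preimage_iUnion, curve]
  exact iUnion_congr fun i => preimage_edgeSet P i

lemma preimage_inside :
    orthonormalBasisOneI.repr ⁻¹' P.inside = enclosed (complexVertices P) := by
  ext x
  have hmem : orthonormalBasisOneI.repr x ∈ P.boundary ℝ ↔ x ∈ curve (complexVertices P) := by
    rw [← preimage_boundary, mem_preimage]
  refine and_congr (not_congr hmem) ?_
  by_cases hx : x ∈ curve (complexVertices P)
  · rw [connectedComponentIn_eq_empty (not_not.2 (hmem.2 hx)),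
      connectedComponentIn_eq_empty (not_not.2 hx)]
    simp
  have h := (orthonormalBasisOneI.repr.toHomeomorph).image_connectedComponentIn
    (s := (curve (complexVertices P))ᶜ) (x := x) hx
  have hF : orthonormalBasisOneI.repr.toHomeomorph '' (curve (complexVertices P))ᶜ =
      (P.boundary ℝ)ᶜ := by
    rw [← preimage_boundary, ← preimage_compl]
    exact image_preimage_eq _ orthonormalBasisOneI.repr.surjective
  rw [hF] at h
  change Bornology.IsBounded (connectedComponentIn (P.boundary ℝ)ᶜ
    (orthonormalBasisOneI.repr.toHomeomorph x)) ↔ _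
  rw [← h]
  constructor
  · intro hb
    have := orthonormalBasisOneI.repr.antilipschitz.isBounded_preimage hb
    refine this.subset ?_
    exact subset_preimage_image _ _
  · intro hb
    exact orthonormalBasisOneI.repr.lipschitz.isBounded_image hb

variable {P}

lemma isSimpleLoop_complexVertices (hP : P.IsSimple) : IsSimpleLoop (complexVertices P) where
  three_le := hP.three_le
  injective := orthonormalBasisOneI.repr.symm.injective.comp hP.injective
  adjacent i := by
    rw [← preimage_edgeSet, ← preimage_edgeSet, ← preimage_inter, hP.adjacent]
    ext x
    rw [mem_preimage, mem_singleton_iff, mem_singleton_iff, complexVertices,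
      LinearIsometryEquiv.eq_symm_apply]
  nonadjacent i j h1 h2 h3 := by
    rw [← preimage_edgeSet, ← preimage_edgeSet]
    exact (hP.nonadjacent i j h1 h2 h3).preimage _

lemma mem_latticePoints_iff (z : ℂ) :
    orthonormalBasisOneI.repr z ∈ latticePoints ↔ z ∈ range latticePt := by
  simp only [latticePoints, mem_ofPred_eq, Fin.forall_fin_two, mem_range,
    orthonormalBasisOneI_repr_apply]
  constructor
  · rintro ⟨⟨a, ha⟩, ⟨b, hb⟩⟩
    refine ⟨(a, b), Complex.ext ?_ ?_⟩
    · simpa using ha.symm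
    · simpa using hb.symm
  · rintro ⟨m, rfl⟩
    exact ⟨⟨m.1, by simp⟩, ⟨m.2, by simp⟩⟩

lemma inter_latticePoints (S : Set (EuclideanSpace ℝ (Fin 2))) :
    S ∩ latticePoints = (fun m => orthonormalBasisOneI.repr (latticePt m)) ''
      (latticePt ⁻¹' (orthonormalBasisOneI.repr ⁻¹' S)) := by
  ext x
  obtain ⟨z, rfl⟩ := orthonormalBasisOneI.repr.surjective x
  rw [mem_inter_iff, mem_latticePoints_iff]
  constructor
  · rintro ⟨h, m, rfl⟩
    exact ⟨m, h, rfl⟩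
  · rintro ⟨m, h, hm⟩
    obtain rfl := orthonormalBasisOneI.repr.injective hm
    exact ⟨h, m, rfl⟩

lemma ncard_inter_latticePoints (S : Set (EuclideanSpace ℝ (Fin 2))) :
    (S ∩ latticePoints).ncard =
      (latticePt ⁻¹' (orthonormalBasisOneI.repr ⁻¹' S)).ncard := by
  rw [inter_latticePoints]
  exact ncard_image_of_injective _ (orthonormalBasisOneI.repr.injective.comp latticePt_injective)

lemma volume_preimage_repr (S : Set (EuclideanSpace ℝ (Fin 2))) :
    volume (orthonormalBasisOneI.repr ⁻¹' S) = volume S :=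
  orthonormalBasisOneI.repr.measurePreserving.measure_preimage_emb
    orthonormalBasisOneI.repr.toHomeomorph.measurableEmbedding S

end Transfer

end PickTheorem

open PickTheorem

theorem mainTheorem1 {n : ℕ} (P : Polygon (EuclideanSpace ℝ (Fin 2)) n)
    (hP : P.IsLatticePolygon) :
    (P.inside ∩ latticePoints).Finite ∧ (P.boundary ℝ ∩ latticePoints).Finite ∧
      MeasureTheory.volume P.region ≠ ⊤ ∧
      (MeasureTheory.volume P.region).toReal =
        ((P.inside ∩ latticePoints).ncard : ℝ)
          + ((P.boundary ℝ ∩ latticePoints).ncard : ℝ) / 2 - 1 := by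
  have hv := isSimpleLoop_complexVertices hP.isSimple
  have hvol : MeasureTheory.volume P.region =
      MeasureTheory.volume (enclosed (complexVertices P)) := by
    rw [← volume_preimage_repr, Polygon.region, Set.preimage_union, preimage_boundary,
      preimage_inside, MeasureTheory.measure_congr
        (MeasureTheory.union_ae_eq_right_of_ae_eq_empty (MeasureTheory.ae_eq_empty.2 (volume_curve _)))]
  refine ⟨?_, ?_, ?_, ?_⟩
  · rw [inter_latticePoints, preimage_inside]
    exact (finite_latticePt_preimage hv.isBounded_enclosed).image _
  · rw [inter_latticePoints, preimage_boundary]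
    exact (finite_latticePt_preimage (isCompact_curve _).isBounded).image _
  · rw [hvol]
    exact hv.isBounded_enclosed.measure_lt_top.ne
  · rw [hvol, ncard_inter_latticePoints, ncard_inter_latticePoints, preimage_inside,
      preimage_boundary]
    refine hv.volume_enclosed fun i => (mem_latticePoints_iff _).1 ?_
    rw [complexVertices, LinearIsometryEquiv.apply_symm_apply]
    exact hP.vertices_mem i
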